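/- Let $M$ be a smooth manifold and $Q$ a (smooth) principal $\mathrm{SO}(2)$-bundle over $M$. Let $L=Q\times_{\mathrm{SO}(2)}\mathbb{R}^2$ be the associated Hermitian line bundle, where $\mathbb{R}^2=\mathbb{C}$ carries its standard Hermitian metric. Consider the following categories; all morphisms are isomorphisms covering $\mathrm{id}_M$. - *Spin structures on $Q$*: principal $\mathrm{Spin}_2$-bundles $P$ over $M$ with a smooth map $P\to Q$ over $M$ that is equivariant along the double cover $\mathrm{Spin}_2\to\mathrm{SO}(2)$, $x\mapsto(v\mapsto xvx^{-1})$; morphisms are isomorphisms of principal $\mathrm{Spin}_2$-bundles commuting with the maps to $Q$. - *Hermitian square roots of $L$*: Hermitian line bundles $N$ over $M$ with a smooth bundle map $N\to L$ over $M$ that on each fibre is complex-quadratic and surjective and sends unit vectors to unit vectors; morphisms are smooth unitary isomorphisms commuting with the maps to $L$. - *Smooth square roots of $L$*: smooth complex line bundles $N$ over $M$ with a smooth bundle map $N\to L$ over $M$ that on each fibre is complex-quadratic and surjective; morphisms are smooth isomorphisms of complex line bundles commuting with the maps to $L$. Then these three categories are equivalent. More precisely, the category of spin structures on $Q$ is equivalent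 to the category of Hermitian square roots of $L$, and the functor from Hermitian to smooth square roots of $L$ that forgets the Hermitian metrics is an equivalence. If moreover $M$ is a complex manifold and $L$ is given a holomorphic structure, then these categories are also equivalent to the category of *holomorphic square roots of $L$*: holomorphic line bundles $N$ over $M$ with a holomorphic bundle map $N\to L$ over $M$ that on each fibre is complex-quadratic and surjective; morphisms are holomorphic isomorphisms of line bundles commuting with the maps to $L$. More precisely, the functor from holomorphic to smooth square roots of $L$ that forgets the holomorphic structures is an equivalence. -/

import Mathlib

open scoped Manifold ContDiff Bundle RightActions

universe w w' w'' v u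

noncomputable section

namespace SquareRoot

open CliffordAlgebra CliffordAlgebraQuaternion Bundle CategoryTheory

/-! ## The groups `Spin₂` and `SO(2)` and the double cover between them -/

/-- The quadratic form `v ↦ -|v|²` on the plane. -/
abbrev planeForm : QuadraticForm ℝ (ℝ × ℝ) := CliffordAlgebraQuaternion.Q (-1 : ℝ) (-1)

/-- The Clifford algebra `Cl₂`: generators `e₁`, `e₂` with `e₁² = e₂² = -1` and
`e₁ e₂ = - e₂ e₁`. -/
abbrev Cl2 : Type := CliffordAlgebra planeForm

/-- The group `Spin₂` inside `Cl₂`. -/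
abbrev Spin2 : Submonoid Cl2 := spinGroup planeForm

/-- The group `SO(2)` of rotation matrices. -/
abbrev SO2 : Submonoid (Matrix (Fin 2) (Fin 2) ℝ) := Matrix.specialOrthogonalGroup (Fin 2) ℝ

/-- The coefficients of `e₁` and `e₂` of an element of `Cl₂` in the basis
`1, e₁, e₂, e₁ e₂`. -/
def coeff (w : Cl2) : ℝ × ℝ := ((toQuaternion w).imI, (toQuaternion w).imJ)

theorem coeff_ι (v : ℝ × ℝ) : coeff (ι planeForm v) = v := by
  simp [coeff, planeForm]

/-- The matrix of `v ↦ x v x⁻¹` on the plane, for `x` in `Spin₂` (where `x⁻¹ = star x`);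
see `ι_conjMatrix`. -/
def conjMatrix (x : Cl2) : Matrix (Fin 2) (Fin 2) ℝ :=
  !![(coeff (x * ι planeForm (1, 0) * star x)).1, (coeff (x * ι planeForm (0, 1) * star x)).1;
     (coeff (x * ι planeForm (1, 0) * star x)).2, (coeff (x * ι planeForm (0, 1) * star x)).2]

theorem toQuaternion_involute (x : Cl2) :
    toQuaternion (involute x) =
      (⟨(toQuaternion x).re, -(toQuaternion x).imI, -(toQuaternion x).imJ,
        (toQuaternion x).imK⟩ : QuaternionAlgebra ℝ (-1) 0 (-1)) := by
  induction x using CliffordAlgebra.induction with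
  | algebraMap r => ext <;> simp [planeForm]
  | ι v => ext <;> simp [planeForm]
  | mul x y hx hy => rw [map_mul, map_mul, hx, hy]; ext <;> simp [planeForm] <;> ring
  | add x y hx hy => rw [map_add, map_add, hx, hy]; ext <;> simp [planeForm] <;> ring

theorem Spin2.exists_coord {x : Cl2} (hx : x ∈ Spin2) :
    ∃ a b : ℝ, a ^ 2 + b ^ 2 = 1 ∧
      toQuaternion x = (⟨a, 0, 0, b⟩ : QuaternionAlgebra ℝ (-1) 0 (-1)) := by
  have h := toQuaternion_involute x
  rw [spinGroup.involute_eq hx] at h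
  have h1 : (toQuaternion x).imI = 0 := by
    have := congrArg QuaternionAlgebra.imI h; simp only at this; linarith
  have h2 : (toQuaternion x).imJ = 0 := by
    have := congrArg QuaternionAlgebra.imJ h; simp only at this; linarith
  have h3 := congrArg toQuaternion (spinGroup.star_mul_self_of_mem hx)
  rw [map_mul, toQuaternion_star, map_one] at h3
  have h4 := congrArg QuaternionAlgebra.re h3
  refine ⟨(toQuaternion x).re, (toQuaternion x).imK, ?_, ?_⟩
  · simp [h1, h2] at h4; linarith
  · ext <;> simp [h1, h2]

theorem toQuaternion_conj {x : Cl2} {a b : ℝ}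
    (hx : toQuaternion x = (⟨a, 0, 0, b⟩ : QuaternionAlgebra ℝ (-1) 0 (-1))) (v : ℝ × ℝ) :
    toQuaternion (x * ι planeForm v * star x) =
      (⟨0, (a ^ 2 - b ^ 2) * v.1 - 2 * a * b * v.2, 2 * a * b * v.1 + (a ^ 2 - b ^ 2) * v.2, 0⟩ :
        QuaternionAlgebra ℝ (-1) 0 (-1)) := by
  rw [map_mul, map_mul, toQuaternion_star, hx, toQuaternion_ι]
  ext <;> simp <;> ring

theorem conjMatrix_eq {x : Cl2} {a b : ℝ}
    (hx : toQuaternion x = (⟨a, 0, 0, b⟩ : QuaternionAlgebra ℝ (-1) 0 (-1))) :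
    conjMatrix x = !![a ^ 2 - b ^ 2, -(2 * a * b); 2 * a * b, a ^ 2 - b ^ 2] := by
  simp [conjMatrix, coeff, toQuaternion_conj hx]

/-- `conjMatrix x` is the matrix of `v ↦ x v x⁻¹`. -/
theorem ι_conjMatrix {x : Cl2} (hx : x ∈ Spin2) (v : ℝ × ℝ) :
    ι planeForm (conjMatrix x 0 0 * v.1 + conjMatrix x 0 1 * v.2,
      conjMatrix x 1 0 * v.1 + conjMatrix x 1 1 * v.2) = x * ι planeForm v * star x := by
  obtain ⟨a, b, -, h⟩ := Spin2.exists_coord hx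
  apply CliffordAlgebraQuaternion.equiv.injective
  rw [equiv_apply, equiv_apply, toQuaternion_conj h, conjMatrix_eq h, toQuaternion_ι]
  ext <;> simp <;> ring

/-- The double cover `Spin₂ → SO(2)`, `x ↦ (v ↦ x v x⁻¹)`. -/
def spinCover : Spin2 →* SO2 where
  toFun x := ⟨conjMatrix x, by
    obtain ⟨a, b, hab, h⟩ := Spin2.exists_coord x.2
    rw [conjMatrix_eq h, Matrix.of_mem_specialOrthogonalGroup_fin_two_iff]
    refine ⟨rfl, rfl, ?_⟩
    linear_combination (a ^ 2 + b ^ 2 + 1) * hab⟩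
  map_one' := by
    apply Subtype.ext
    have h : toQuaternion (1 : Cl2) = (⟨1, 0, 0, 0⟩ : QuaternionAlgebra ℝ (-1) 0 (-1)) := by
      rw [map_one]; rfl
    change conjMatrix 1 = 1
    rw [conjMatrix_eq h]
    ext i j
    fin_cases i <;> fin_cases j <;> simp
  map_mul' x y := by
    apply Subtype.ext
    obtain ⟨a, b, -, hx⟩ := Spin2.exists_coord x.2
    obtain ⟨c, d, -, hy⟩ := Spin2.exists_coord y.2
    have hxy : toQuaternion ((x : Cl2) * (y : Cl2)) =
        (⟨a * c - b * d, 0, 0, a * d + b * c⟩ : QuaternionAlgebra ℝ (-1) 0 (-1)) := by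
      rw [map_mul, hx, hy]; ext <;> simp
    change conjMatrix ((x : Cl2) * (y : Cl2)) = conjMatrix x * conjMatrix y
    rw [conjMatrix_eq hx, conjMatrix_eq hy, conjMatrix_eq hxy]
    ext i j; fin_cases i <;> fin_cases j <;> simp [Matrix.mul_apply] <;> ring

/-- The identification of `SO(2)` with the unit circle: the matrix of the rotation through `θ`
goes to `exp (iθ)`. -/
def SO2.toComplex (A : SO2) : ℂ :=
  ⟨(A : Matrix (Fin 2) (Fin 2) ℝ) 0 0, (A : Matrix (Fin 2) (Fin 2) ℝ) 1 0⟩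

theorem SO2.toComplex_one : SO2.toComplex 1 = 1 := by
  apply Complex.ext <;> simp [SO2.toComplex]

theorem SO2.toComplex_mul (A B : SO2) :
    SO2.toComplex (A * B) = SO2.toComplex A * SO2.toComplex B := by
  obtain ⟨h1, h2, -⟩ := Matrix.mem_specialOrthogonalGroup_fin_two_iff.1 A.2
  apply Complex.ext <;> simp [SO2.toComplex, Matrix.mul_apply] <;> grind

/-- Under the identification of `ℝ²` with `ℂ`, the action of a rotation matrix is multiplication
by the corresponding complex number. -/
theorem SO2.toComplex_mul_eq_mulVec (A : SO2) (v : Fin 2 → ℝ) :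
    SO2.toComplex A * ⟨v 0, v 1⟩ = ⟨((A : Matrix (Fin 2) (Fin 2) ℝ).mulVec v) 0,
      ((A : Matrix (Fin 2) (Fin 2) ℝ).mulVec v) 1⟩ := by
  obtain ⟨h1, h2, -⟩ := Matrix.mem_specialOrthogonalGroup_fin_two_iff.1 A.2
  apply Complex.ext <;> simp [SO2.toComplex, Matrix.mulVec, dotProduct, Fin.sum_univ_two] <;> grind

theorem SO2.conj_mul_toComplex (A : SO2) :
    (starRingEnd ℂ) (SO2.toComplex A) * SO2.toComplex A = 1 := by
  obtain ⟨h1, h2, h3⟩ := Matrix.mem_specialOrthogonalGroup_fin_two_iff.1 A.2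
  apply Complex.ext <;> simp [SO2.toComplex] <;> grind

/-! ## Principal bundles -/

section Principal

variable {A : Type*} [Ring A] [Algebra ℝ A]
  {E : Type v} [NormedAddCommGroup E] [NormedSpace ℝ E]
  {M : Type u} [TopologicalSpace M] [ChartedSpace E M]

variable (E) in
/-- Smoothness on `s` of a map `f` from the manifold `M` (with model space `E`) to a
finite-dimensional real vector space `A` that carries no preferred norm: all linear coordinates
of `f` are smooth.  For a closed group `G` of units of a finite-dimensional algebra `A`, such as
`SO(2)` or `Spin₂`, a map to the Lie group `G` is smooth if and only if it is smooth
as a map to `A`. -/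
def SmoothInto (f : M → A) (s : Set M) : Prop :=
  ∀ φ : A →ₗ[ℝ] ℝ, ContMDiffOn 𝓘(ℝ, E) 𝓘(ℝ) ∞ (fun x => φ (f x)) s

/-- A local section over an open set of a family `P` of sets over `M`. -/
structure LocalSection (P : M → Type w) where
  domain : TopologicalSpace.Opens M
  toFun : ∀ x, x ∈ domain → P x

/-- The image of a local section under a map over `M`. -/
def LocalSection.map {P : M → Type w} {P' : M → Type w'} (f : ∀ x, P x → P' x)
    (σ : LocalSection P) : LocalSection P' :=
  ⟨σ.domain, fun x hx => f x (σ.toFun x hx)⟩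

variable (E) in
/-- The section `σ` is smooth in the local trivialization `(x, g) ↦ τ x · g` given by the local
section `τ`: one has `σ = τ · g` on the common domain, with a smooth `G`-valued function `g`. -/
def LocalSection.SmoothRel (G : Submonoid A) {P : M → Type w} [∀ x, MulAction (↥G)ᵐᵒᵖ (P x)]
    (σ τ : LocalSection P) : Prop :=
  ∃ g : M → G, SmoothInto E (fun x => (g x : A)) (σ.domain ∩ τ.domain : Set M) ∧
    ∀ x (hσ : x ∈ σ.domain) (hτ : x ∈ τ.domain), σ.toFun x hσ = τ.toFun x hτ <• g x

variable (E M) in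
/-- A smooth principal `G`-bundle over `M`, where `G` is a closed group of units of a
finite-dimensional real algebra `A`.  The fibres carry free and transitive right
actions of `G`, and there is an atlas of local sections `τ` over open sets covering `M`,
equivalently of `G`-equivariant local trivializations `(x, g) ↦ τ x · g`, whose transition
functions are smooth.  (The total space has a unique smooth structure for which these local
trivializations are diffeomorphisms onto open sets.) -/
structure PrincipalBundle (G : Submonoid A) where
  Fiber : M → Type w
  [action : ∀ x, MulAction (↥G)ᵐᵒᵖ (Fiber x)]
  existsUnique_smul : ∀ x (p q : Fiber x), ∃! g : G, p <• g = q
  atlas : Set (LocalSection Fiber)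
  exists_mem_atlas : ∀ x, ∃ τ ∈ atlas, x ∈ τ.domain
  smooth_atlas : ∀ σ ∈ atlas, ∀ τ ∈ atlas, LocalSection.SmoothRel E G σ τ

attribute [instance] PrincipalBundle.action

namespace PrincipalBundle

variable {G : Submonoid A}

/-- A local section of a principal bundle is smooth if it is smooth in every local trivialization
of the atlas. -/
def IsSmooth (P : PrincipalBundle.{w} E M G) (σ : LocalSection P.Fiber) : Prop :=
  ∀ τ ∈ P.atlas, LocalSection.SmoothRel E G σ τ

/-- A map over `M` between principal bundles (equivariant along a morphism of the structure groups)
is smooth if it sends smooth local sections to smooth local sections. -/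
def SmoothMap {A' : Type*} [Ring A'] [Algebra ℝ A'] {G' : Submonoid A'}
    (P : PrincipalBundle.{w} E M G) (P' : PrincipalBundle.{w'} E M G')
    (f : ∀ x, P.Fiber x → P'.Fiber x) : Prop :=
  ∀ σ : LocalSection P.Fiber, P.IsSmooth σ → P'.IsSmooth (σ.map f)

/-- An isomorphism of principal `G`-bundles over `M` (covering the identity of `M`). -/
@[ext]
structure Iso (P : PrincipalBundle.{w} E M G) (P' : PrincipalBundle.{w'} E M G) where
  toEquiv : ∀ x, P.Fiber x ≃ P'.Fiber x
  map_smul : ∀ x p (g : G), toEquiv x (p <• g) = toEquiv x p <• g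
  smooth : P.SmoothMap P' fun x => toEquiv x
  smooth_symm : P'.SmoothMap P fun x => (toEquiv x).symm

namespace Iso

/-- The identity. -/
protected def refl (P : PrincipalBundle.{w} E M G) : Iso P P where
  toEquiv _ := Equiv.refl _
  map_smul _ _ _ := rfl
  smooth _ h := h
  smooth_symm _ h := h

/-- Composition. -/
protected def trans {P P' P'' : PrincipalBundle.{w} E M G} (φ : Iso P P') (ψ : Iso P' P'') :
    Iso P P'' where
  toEquiv x := (φ.toEquiv x).trans (ψ.toEquiv x)
  map_smul x p g := by simp [φ.map_smul, ψ.map_smul]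
  smooth σ h := ψ.smooth _ (φ.smooth σ h)
  smooth_symm σ h := φ.smooth_symm _ (ψ.smooth_symm σ h)

end Iso

/-- The element `g` of `G` with `p · g = q`. -/
def diff (P : PrincipalBundle.{w} E M G) {x : M} (p q : P.Fiber x) : G :=
  (P.existsUnique_smul x p q).choose

theorem smul_diff (P : PrincipalBundle.{w} E M G) {x : M} (p q : P.Fiber x) :
    p <• P.diff p q = q :=
  (P.existsUnique_smul x p q).choose_spec.1

theorem diff_eq (P : PrincipalBundle.{w} E M G) {x : M} {p q : P.Fiber x} {g : G}
    (h : p <• g = q) : P.diff p q = g :=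
  ((P.existsUnique_smul x p q).choose_spec.2 g h).symm

theorem diff_mul_diff (P : PrincipalBundle.{w} E M G) {x : M} (p q r : P.Fiber x) :
    P.diff p q * P.diff q r = P.diff p r := by
  refine (P.diff_eq ?_).symm
  rw [MulOpposite.op_mul, mul_smul, P.smul_diff, P.smul_diff]

theorem diff_self (P : PrincipalBundle.{w} E M G) {x : M} (p : P.Fiber x) : P.diff p p = 1 :=
  P.diff_eq (by simp)

end PrincipalBundle

end Principal

/-! ## Spin structures -/

section Real

variable {E : Type v} [NormedAddCommGroup E] [NormedSpace ℝ E]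
  {M : Type u} [TopologicalSpace M] [ChartedSpace E M]

/-- A spin structure on a principal `SO(2)`-bundle `Q`: a principal `Spin₂`-bundle with a smooth map
to `Q` over `M` that is equivariant along the double cover `Spin₂ → SO(2)`. -/
structure SpinStructure (Q : PrincipalBundle.{w'} E M SO2) where
  bundle : PrincipalBundle.{w} E M Spin2
  toFun : ∀ x, bundle.Fiber x → Q.Fiber x
  map_smul : ∀ x p (s : Spin2), toFun x (p <• s) = toFun x p <• spinCover s
  smooth : bundle.SmoothMap Q toFun

namespace SpinStructure

variable {Q : PrincipalBundle.{w'} E M SO2}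

/-- An equivalence of spin structures: an isomorphism of principal `Spin₂`-bundles commuting with
the maps to `Q`. -/
@[ext]
structure Hom (P P' : SpinStructure.{w} Q) extends PrincipalBundle.Iso P.bundle P'.bundle where
  comm : ∀ x p, P'.toFun x (toEquiv x p) = P.toFun x p

/-- The category of spin structures on `Q`. -/
instance : Category (SpinStructure.{w} Q) where
  Hom := Hom
  id P := { PrincipalBundle.Iso.refl P.bundle with comm := fun _ _ => rfl }
  comp φ ψ := { φ.toIso.trans ψ.toIso with
    comm := fun x p => (ψ.comm x (φ.toEquiv x p)).trans (φ.comm x p) }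

end SpinStructure

/-! ## Complex line bundles -/

/-- A complex vector bundle with model fibre `ℂ` is in particular a real vector bundle. -/
instance vectorBundleReal (V : M → Type*)
    [TopologicalSpace (TotalSpace ℂ V)] [∀ x, AddCommGroup (V x)] [∀ x, Module ℂ (V x)]
    [∀ x, TopologicalSpace (V x)] [FiberBundle ℂ V] [VectorBundle ℂ ℂ V] :
    VectorBundle ℝ ℂ V where
  trivialization_linear' e _ := ⟨fun x hx =>
    { map_add := (e.linear ℂ hx).map_add
      map_smul := fun c v => (e.linear ℂ hx).map_smul (c : ℂ) v }⟩
  continuousOn_coordChange' e e' _ _ := by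
    have h := continuousOn_coordChange ℂ e e'
    have : e.IsLinear ℝ := ⟨fun x hx =>
      { map_add := (e.linear ℂ hx).map_add
        map_smul := fun c v => (e.linear ℂ hx).map_smul (c : ℂ) v }⟩
    have : e'.IsLinear ℝ := ⟨fun x hx =>
      { map_add := (e'.linear ℂ hx).map_add
        map_smul := fun c v => (e'.linear ℂ hx).map_smul (c : ℂ) v }⟩
    refine ((ContinuousLinearMap.restrictScalarsL ℂ ℂ ℂ ℝ ℝ).continuous.comp_continuousOn h).congr
      fun x hx => ?_
    ext v; simp [Trivialization.coordChangeL_apply' e e' hx]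

variable (E M) in
/-- A smooth complex line bundle over the manifold `M` (with model space `E`). -/
structure SmoothLineBundle where
  Fiber : M → Type w
  [topTotal : TopologicalSpace (TotalSpace ℂ Fiber)]
  [addCommGroup : ∀ x, AddCommGroup (Fiber x)]
  [module : ∀ x, Module ℂ (Fiber x)]
  [topFiber : ∀ x, TopologicalSpace (Fiber x)]
  [fiberBundle : FiberBundle ℂ Fiber]
  [vectorBundle : VectorBundle ℂ ℂ Fiber]
  [smooth : ContMDiffVectorBundle ∞ ℂ Fiber 𝓘(ℝ, E)]

attribute [instance] SmoothLineBundle.topTotal SmoothLineBundle.addCommGroup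
  SmoothLineBundle.module SmoothLineBundle.topFiber SmoothLineBundle.fiberBundle
  SmoothLineBundle.vectorBundle SmoothLineBundle.smooth

namespace SmoothLineBundle

/-- A map over `M` between line bundles is smooth if it is smooth as a map between the total
spaces. -/
def SmoothMap (N : SmoothLineBundle.{w} E M) (N' : SmoothLineBundle.{w'} E M)
    (f : ∀ x, N.Fiber x → N'.Fiber x) : Prop :=
  ContMDiff (𝓘(ℝ, E).prod 𝓘(ℝ, ℂ)) (𝓘(ℝ, E).prod 𝓘(ℝ, ℂ)) ∞
    fun p : TotalSpace ℂ N.Fiber => TotalSpace.mk' ℂ p.proj (f p.proj p.2)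

/-- A smooth isomorphism of complex line bundles over `M`. -/
@[ext]
structure Iso (N : SmoothLineBundle.{w} E M) (N' : SmoothLineBundle.{w'} E M) where
  toEquiv : ∀ x, N.Fiber x ≃ₗ[ℂ] N'.Fiber x
  smooth : N.SmoothMap N' fun x => toEquiv x
  smooth_symm : N'.SmoothMap N fun x => (toEquiv x).symm

namespace Iso

/-- The identity. -/
protected def refl (N : SmoothLineBundle.{w} E M) : Iso N N where
  toEquiv _ := LinearEquiv.refl _ _
  smooth := contMDiff_id
  smooth_symm := contMDiff_id

/-- Composition. -/
protected def trans {N N' N'' : SmoothLineBundle.{w} E M} (φ : Iso N N') (ψ : Iso N' N'') :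
    Iso N N'' where
  toEquiv x := (φ.toEquiv x).trans (ψ.toEquiv x)
  smooth := ContMDiff.comp ψ.smooth φ.smooth
  smooth_symm := ContMDiff.comp φ.smooth_symm ψ.smooth_symm

end Iso

end SmoothLineBundle

variable (E M) in
/-- A Hermitian line bundle: a smooth complex line bundle with a smooth Hermitian metric
(conjugate-linear in the first variable).  Smoothness is that of the coefficients of the metric in
the local trivializations. -/
structure HermitianLineBundle extends SmoothLineBundle.{w} E M where
  metric : ∀ x, Fiber x →ₗ⋆[ℂ] Fiber x →ₗ[ℂ] ℂ
  conj_symm : ∀ x a b, (starRingEnd ℂ) (metric x a b) = metric x b a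
  pos : ∀ x a, a ≠ 0 → 0 < (metric x a a).re
  smooth_metric : ∀ (e : Trivialization ℂ (π ℂ Fiber)) [MemTrivializationAtlas e] (a b : ℂ),
    ContMDiffOn 𝓘(ℝ, E) 𝓘(ℝ, ℂ) ∞ (fun x => metric x (e.symm x a) (e.symm x b)) e.baseSet

/-! ## Smooth and Hermitian square roots -/

/-- A smooth square root of the line bundle `L`: a smooth complex line bundle with a smooth bundle map
to `L` over `M` that is complex-quadratic and surjective (equivalently, nonzero) on each fibre. -/
structure SmoothSqrt (L : SmoothLineBundle.{w'} E M) where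
  bundle : SmoothLineBundle.{w} E M
  quad : ∀ x, QuadraticMap ℂ (bundle.Fiber x) (L.Fiber x)
  surjective : ∀ x, Function.Surjective (quad x)
  smooth : bundle.SmoothMap L fun x => quad x

namespace SmoothSqrt

variable {L : SmoothLineBundle.{w'} E M}

/-- An equivalence of smooth square roots: a smooth isomorphism of complex line bundles commuting
with the quadratic maps to `L`. -/
@[ext]
structure Hom (N N' : SmoothSqrt.{w} L) extends SmoothLineBundle.Iso N.bundle N'.bundle where
  comm : ∀ x a, N'.quad x (toEquiv x a) = N.quad x a

/-- The category of smooth square roots of `L`. -/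
instance : Category (SmoothSqrt.{w} L) where
  Hom := Hom
  id N := { SmoothLineBundle.Iso.refl N.bundle with comm := fun _ _ => rfl }
  comp φ ψ := { φ.toIso.trans ψ.toIso with
    comm := fun x a => (ψ.comm x (φ.toEquiv x a)).trans (φ.comm x a) }

end SmoothSqrt

/-- A Hermitian square root of the Hermitian line bundle `L`: a Hermitian line bundle with a smooth
bundle map onto `L` over `M` that is complex-quadratic on each fibre and sends unit vectors to unit
vectors. -/
structure HermitianSqrt (L : HermitianLineBundle.{w'} E M) where
  bundle : HermitianLineBundle.{w} E M
  quad : ∀ x, QuadraticMap ℂ (bundle.Fiber x) (L.Fiber x)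
  surjective : ∀ x, Function.Surjective (quad x)
  smooth : bundle.SmoothMap L.toSmoothLineBundle fun x => quad x
  unit : ∀ x a, bundle.metric x a a = 1 → L.metric x (quad x a) (quad x a) = 1

namespace HermitianSqrt

variable {L : HermitianLineBundle.{w'} E M}

/-- An equivalence of Hermitian square roots: a smooth unitary isomorphism commuting with the
quadratic maps to `L`. -/
@[ext]
structure Hom (N N' : HermitianSqrt.{w} L) extends
    SmoothLineBundle.Iso N.bundle.toSmoothLineBundle N'.bundle.toSmoothLineBundle where
  unitary : ∀ x a b, N'.bundle.metric x (toEquiv x a) (toEquiv x b) = N.bundle.metric x a b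
  comm : ∀ x a, N'.quad x (toEquiv x a) = N.quad x a

/-- The category of Hermitian square roots of `L`. -/
instance : Category (HermitianSqrt.{w} L) where
  Hom := Hom
  id N := { SmoothLineBundle.Iso.refl N.bundle.toSmoothLineBundle with
    unitary := fun _ _ _ => rfl
    comm := fun _ _ => rfl }
  comp φ ψ := { φ.toIso.trans ψ.toIso with
    unitary := fun x a b =>
      (ψ.unitary x (φ.toEquiv x a) (φ.toEquiv x b)).trans (φ.unitary x a b)
    comm := fun x a => (ψ.comm x (φ.toEquiv x a)).trans (φ.comm x a) }

variable (L) in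
/-- The functor that forgets the Hermitian metrics. -/
def forget : HermitianSqrt.{w} L ⥤ SmoothSqrt.{w} L.toSmoothLineBundle where
  obj N :=
    { bundle := N.bundle.toSmoothLineBundle
      quad := N.quad
      surjective := N.surjective
      smooth := N.smooth }
  map φ := { φ.toIso with comm := φ.comm }

end HermitianSqrt

/-! ## The Hermitian line bundle associated with a principal `SO(2)`-bundle -/

namespace PrincipalBundle

variable (Q : PrincipalBundle.{w} E M SO2)

open Classical in
/-- The transition function from the local trivialization given by the section `i` to the one given
by the section `j`: the unit complex number `c` with `i x = j x · c`. -/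
def transition (i j : Q.atlas) (x : M) : ℂ :=
  if h : x ∈ i.1.domain ∧ x ∈ j.1.domain then
    SO2.toComplex (Q.diff (j.1.toFun x h.2) (i.1.toFun x h.1))
  else 1

theorem transition_of_mem (i j : Q.atlas) {x : M} (hi : x ∈ i.1.domain) (hj : x ∈ j.1.domain) :
    Q.transition i j x = SO2.toComplex (Q.diff (j.1.toFun x hj) (i.1.toFun x hi)) :=
  dif_pos ⟨hi, hj⟩

theorem conj_transition_mul (i j : Q.atlas) (x : M) :
    (starRingEnd ℂ) (Q.transition i j x) * Q.transition i j x = 1 := by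
  unfold transition
  split_ifs
  · exact SO2.conj_mul_toComplex _
  · simp

theorem contMDiffOn_transition (i j : Q.atlas) :
    ContMDiffOn 𝓘(ℝ, E) 𝓘(ℝ, ℂ) ∞ (Q.transition i j) (i.1.domain ∩ j.1.domain : Set M) := by
  obtain ⟨g, hg, h⟩ := Q.smooth_atlas i.1 i.2 j.1 j.2
  have h0 := hg (Matrix.entryLinearMap ℝ ℝ 0 0)
  have h1 := hg (Matrix.entryLinearMap ℝ ℝ 1 0)
  have h2 : ContMDiffOn 𝓘(ℝ, E) 𝓘(ℝ, ℂ) ∞ (fun x => SO2.toComplex (g x))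
      (i.1.domain ∩ j.1.domain : Set M) :=
    Complex.equivRealProdCLM.symm.contDiff.contMDiff.comp_contMDiffOn (h0.prodMk_space h1)
  refine h2.congr fun x hx => ?_
  rw [Q.transition_of_mem i j hx.1 hx.2, Q.diff_eq (h x hx.1 hx.2).symm]

/-- The gluing data of the associated line bundle `Q ×_{SO(2)} ℂ`: the trivial bundles with fibre
`ℂ` over the domains of the sections in the atlas of `Q`, glued along the transition functions
of `Q`. -/
def associatedCore : VectorBundleCore ℂ M ℂ Q.atlas where
  baseSet i := i.1.domain
  isOpen_baseSet i := i.1.domain.isOpen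
  indexAt x := ⟨(Q.exists_mem_atlas x).choose, (Q.exists_mem_atlas x).choose_spec.1⟩
  mem_baseSet_at x := (Q.exists_mem_atlas x).choose_spec.2
  coordChange i j x := Q.transition i j x • ContinuousLinearMap.id ℂ ℂ
  coordChange_self i x hx z := by
    simp [Q.transition_of_mem i i hx hx, Q.diff_self, SO2.toComplex_one]
  continuousOn_coordChange i j :=
    (Q.contMDiffOn_transition i j).continuousOn.smul continuousOn_const
  coordChange_comp i j k x hx z := by
    obtain ⟨⟨hi, hj⟩, hk⟩ := hx
    simp only [smul_apply, ContinuousLinearMap.id_apply, smul_eq_mul]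
    rw [Q.transition_of_mem i j hi hj, Q.transition_of_mem j k hj hk,
      Q.transition_of_mem i k hi hk, ← mul_assoc, ← SO2.toComplex_mul, Q.diff_mul_diff]

theorem contMDiffVectorBundle_associatedCore :
    ContMDiffVectorBundle ∞ ℂ Q.associatedCore.Fiber 𝓘(ℝ, E) where
  contMDiffOn_coordChangeL := by
    rintro _ _ ⟨i, rfl⟩ ⟨j, rfl⟩
    have : MemTrivializationAtlas (Q.associatedCore.localTriv i) := ⟨⟨i, rfl⟩⟩
    have : MemTrivializationAtlas (Q.associatedCore.localTriv j) := ⟨⟨j, rfl⟩⟩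
    have := VectorBundle.trivialization_linear' (R := ℂ) (Q.associatedCore.localTriv i)
    have := VectorBundle.trivialization_linear' (R := ℂ) (Q.associatedCore.localTriv j)
    have := VectorBundle.trivialization_linear' (R := ℝ) (Q.associatedCore.localTriv i)
    have := VectorBundle.trivialization_linear' (R := ℝ) (Q.associatedCore.localTriv j)
    refine ((ContinuousLinearMap.mul ℝ ℂ).contMDiff.comp_contMDiffOn
      (Q.contMDiffOn_transition i j)).congr fun x hx => ContinuousLinearMap.ext fun z => ?_
    exact (Trivialization.coordChangeL_apply' (R := ℝ) (Q.associatedCore.localTriv i)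
        (Q.associatedCore.localTriv j) hx z).trans
      ((Trivialization.coordChangeL_apply' (R := ℂ) (Q.associatedCore.localTriv i)
        (Q.associatedCore.localTriv j) hx z).symm.trans
          (Q.associatedCore.localTriv_coordChange_eq i j hx z))

/-- The standard Hermitian metric `(a, b) ↦ conj a * b` on the fibres of the associated line
bundle. -/
def associatedMetric (x : M) :
    Q.associatedCore.Fiber x →ₗ⋆[ℂ] Q.associatedCore.Fiber x →ₗ[ℂ] ℂ :=
  LinearMap.mk₂'ₛₗ (starRingEnd ℂ) (RingHom.id ℂ)
    (fun a b => (starRingEnd ℂ) (show ℂ from a) * (show ℂ from b))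
    (fun (a b c : ℂ) => by
      change (starRingEnd ℂ) (a + b) * c = (starRingEnd ℂ) a * c + (starRingEnd ℂ) b * c
      rw [map_add, add_mul])
    (fun (t a b : ℂ) => by
      change (starRingEnd ℂ) (t * a) * b = (starRingEnd ℂ) t * ((starRingEnd ℂ) a * b)
      rw [map_mul, mul_assoc])
    (fun (a b c : ℂ) => mul_add _ b c)
    (fun (t a b : ℂ) => mul_left_comm _ t b)

/-- The Hermitian line bundle `L = Q ×_{SO(2)} ℝ²` associated with `Q`, where `ℝ²` is
identified with `ℂ`.  The Hermitian metric is the standard one of `ℂ`, which is preserved by the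
transition functions. -/
def associatedLineBundle : HermitianLineBundle.{0} E M where
  Fiber := Q.associatedCore.Fiber
  smooth := Q.contMDiffVectorBundle_associatedCore
  metric := Q.associatedMetric
  conj_symm _ (a b : ℂ) := by
    change (starRingEnd ℂ) ((starRingEnd ℂ) a * b) = (starRingEnd ℂ) b * a
    rw [map_mul, Complex.conj_conj, mul_comm]
  pos _ (a : ℂ) (ha : a ≠ 0) := by
    change 0 < ((starRingEnd ℂ) a * a).re
    rw [← Complex.normSq_eq_conj_mul_self, Complex.ofReal_re]
    exact Complex.normSq_pos.2 ha
  smooth_metric := by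
    rintro _ ⟨i, rfl⟩ a b
    refine (contMDiffOn_const (c := (starRingEnd ℂ) a * b)).congr fun x hx => ?_
    have h := Q.conj_transition_mul i (Q.associatedCore.indexAt x) x
    refine (congrArg₂ (fun u v => Q.associatedMetric x u v)
      (Q.associatedCore.localTriv_symm_apply i hx a)
      (Q.associatedCore.localTriv_symm_apply i hx b)).trans ?_
    change (starRingEnd ℂ) (Q.transition i (Q.associatedCore.indexAt x) x * a) *
      (Q.transition i (Q.associatedCore.indexAt x) x * b) = _
    rw [map_mul]
    linear_combination (starRingEnd ℂ) a * b * h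

/-- The class `[q, z]` in `L = Q ×_{SO(2)} ℂ`, where `[q · g, z] = [q, g z]`. -/
def associatedMk {x : M} (q : Q.Fiber x) (z : ℂ) : Q.associatedLineBundle.Fiber x :=
  (SO2.toComplex (Q.diff ((Q.associatedCore.indexAt x).1.toFun x
    (Q.associatedCore.mem_baseSet_at x)) q) * z : ℂ)

theorem associatedMk_smul {x : M} (q : Q.Fiber x) (g : SO2) (z : ℂ) :
    Q.associatedMk (q <• g) z = Q.associatedMk q (SO2.toComplex g * z) := by
  have h : Q.diff q (q <• g) = g := Q.diff_eq rfl
  have h' := Q.diff_mul_diff ((Q.associatedCore.indexAt x).1.toFun x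
    (Q.associatedCore.mem_baseSet_at x)) q (q <• g)
  unfold associatedMk
  rw [← h', SO2.toComplex_mul, h, mul_assoc]

theorem associatedMk_bijective {x : M} (q : Q.Fiber x) :
    Function.Bijective (Q.associatedMk q) :=
  mulLeft_bijective₀ _ (right_ne_zero_of_mul_eq_one (SO2.conj_mul_toComplex _))

end PrincipalBundle

end Real

/-! ## Holomorphic line bundles and their square roots

A complex manifold `M` is modelled on a complex vector space `E`; its underlying smooth manifold
has the same charts, with `E` regarded as a real vector space. Holomorphic maps are
the complex analytic ones. -/

section Holomorphic

theorem contMDiffOn_restrictScalars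
    {E F : Type*} [NormedAddCommGroup E] [NormedSpace ℂ E] [NormedAddCommGroup F] [NormedSpace ℂ F]
    {M N : Type*} [TopologicalSpace M] [ChartedSpace E M] [TopologicalSpace N] [ChartedSpace F N]
    {f : M → N} {s : Set M} (h : ContMDiffOn 𝓘(ℂ, E) 𝓘(ℂ, F) ω f s) :
    ContMDiffOn 𝓘(ℝ, E) 𝓘(ℝ, F) ∞ f s := by
  intro x hx
  have := h x hx
  rw [contMDiffWithinAt_iff] at this ⊢
  exact ⟨this.1, (this.2.restrict_scalars ℝ).of_le le_top⟩

theorem contMDiff_prod_restrictScalars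
    {E F E' F' : Type*} [NormedAddCommGroup E] [NormedSpace ℂ E] [NormedAddCommGroup F]
    [NormedSpace ℂ F] [NormedAddCommGroup E'] [NormedSpace ℂ E'] [NormedAddCommGroup F']
    [NormedSpace ℂ F']
    {M N : Type*} [TopologicalSpace M] [ChartedSpace (ModelProd E E') M]
    [TopologicalSpace N] [ChartedSpace (ModelProd F F') N]
    {f : M → N} (h : ContMDiff (𝓘(ℂ, E).prod 𝓘(ℂ, E')) (𝓘(ℂ, F).prod 𝓘(ℂ, F')) ω f) :
    ContMDiff (𝓘(ℝ, E).prod 𝓘(ℝ, E')) (𝓘(ℝ, F).prod 𝓘(ℝ, F')) ∞ f := by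
  intro x
  have := h x
  rw [ContMDiffAt, contMDiffWithinAt_iff] at this ⊢
  exact ⟨this.1, (this.2.restrict_scalars ℝ).of_le le_top⟩

theorem contMDiffVectorBundle_restrictScalars
    {E : Type*} [NormedAddCommGroup E] [NormedSpace ℂ E]
    {M : Type*} [TopologicalSpace M] [ChartedSpace E M] (V : M → Type*)
    [TopologicalSpace (TotalSpace ℂ V)] [∀ x, AddCommGroup (V x)] [∀ x, Module ℂ (V x)]
    [∀ x, TopologicalSpace (V x)] [FiberBundle ℂ V] [VectorBundle ℂ ℂ V]
    [ContMDiffVectorBundle ω ℂ V 𝓘(ℂ, E)] : ContMDiffVectorBundle ∞ ℂ V 𝓘(ℝ, E) where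
  contMDiffOn_coordChangeL e e' _ _ := by
    have h := contMDiffOn_restrictScalars
      (contMDiffOn_coordChangeL (n := ω) (IB := 𝓘(ℂ, E)) (𝕜 := ℂ) e e')
    refine ((ContinuousLinearMap.restrictScalarsL ℂ ℂ ℂ ℝ ℝ).contMDiff.comp_contMDiffOn h).congr
      fun x hx => ?_
    ext v; simp [Trivialization.coordChangeL_apply' e e' hx]

variable {E : Type v} [NormedAddCommGroup E] [NormedSpace ℂ E]
  {M : Type u} [TopologicalSpace M] [ChartedSpace E M]

variable (E M) in
/-- A holomorphic line bundle over the complex manifold `M` (with model space `E`). -/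
structure HolomorphicLineBundle where
  Fiber : M → Type w
  [topTotal : TopologicalSpace (TotalSpace ℂ Fiber)]
  [addCommGroup : ∀ x, AddCommGroup (Fiber x)]
  [module : ∀ x, Module ℂ (Fiber x)]
  [topFiber : ∀ x, TopologicalSpace (Fiber x)]
  [fiberBundle : FiberBundle ℂ Fiber]
  [vectorBundle : VectorBundle ℂ ℂ Fiber]
  [holomorphic : ContMDiffVectorBundle ω ℂ Fiber 𝓘(ℂ, E)]

attribute [instance] HolomorphicLineBundle.topTotal HolomorphicLineBundle.addCommGroup
  HolomorphicLineBundle.module HolomorphicLineBundle.topFiber HolomorphicLineBundle.fiberBundle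
  HolomorphicLineBundle.vectorBundle HolomorphicLineBundle.holomorphic

namespace HolomorphicLineBundle

/-- The underlying smooth complex line bundle. -/
def toSmooth (N : HolomorphicLineBundle.{w} E M) : SmoothLineBundle.{w} E M where
  Fiber := N.Fiber
  smooth := contMDiffVectorBundle_restrictScalars N.Fiber

/-- A map over `M` between holomorphic line bundles is holomorphic if it is so as a map between the
total spaces. -/
def HolomorphicMap (N : HolomorphicLineBundle.{w} E M) (N' : HolomorphicLineBundle.{w'} E M)
    (f : ∀ x, N.Fiber x → N'.Fiber x) : Prop :=
  ContMDiff (𝓘(ℂ, E).prod 𝓘(ℂ, ℂ)) (𝓘(ℂ, E).prod 𝓘(ℂ, ℂ)) ω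
    fun p : TotalSpace ℂ N.Fiber => TotalSpace.mk' ℂ p.proj (f p.proj p.2)

theorem HolomorphicMap.smoothMap {N : HolomorphicLineBundle.{w} E M}
    {N' : HolomorphicLineBundle.{w'} E M} {f : ∀ x, N.Fiber x → N'.Fiber x}
    (h : N.HolomorphicMap N' f) : N.toSmooth.SmoothMap N'.toSmooth f :=
  contMDiff_prod_restrictScalars h

/-- A holomorphic isomorphism of line bundles over `M`. -/
@[ext]
structure Iso (N : HolomorphicLineBundle.{w} E M) (N' : HolomorphicLineBundle.{w'} E M) where
  toEquiv : ∀ x, N.Fiber x ≃ₗ[ℂ] N'.Fiber x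
  holomorphic : N.HolomorphicMap N' fun x => toEquiv x
  holomorphic_symm : N'.HolomorphicMap N fun x => (toEquiv x).symm

namespace Iso

/-- The identity. -/
protected def refl (N : HolomorphicLineBundle.{w} E M) : Iso N N where
  toEquiv _ := LinearEquiv.refl _ _
  holomorphic := contMDiff_id
  holomorphic_symm := contMDiff_id

/-- Composition. -/
protected def trans {N N' N'' : HolomorphicLineBundle.{w} E M} (φ : Iso N N') (ψ : Iso N' N'') :
    Iso N N'' where
  toEquiv x := (φ.toEquiv x).trans (ψ.toEquiv x)
  holomorphic := ContMDiff.comp ψ.holomorphic φ.holomorphic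
  holomorphic_symm := ContMDiff.comp φ.holomorphic_symm ψ.holomorphic_symm

end Iso

end HolomorphicLineBundle

/-- A holomorphic structure on a smooth complex line bundle `L` over a complex manifold: a
holomorphic line bundle with an identification of its underlying smooth complex line
bundle with `L`. -/
structure HolomorphicStructure (L : SmoothLineBundle.{w} E M) where
  bundle : HolomorphicLineBundle.{w'} E M
  iso : SmoothLineBundle.Iso bundle.toSmooth L

/-- A holomorphic square root of the holomorphic line bundle `L`: a holomorphic line bundle with a
holomorphic bundle map onto `L` over `M` that is complex-quadratic on each fibre. -/
structure HolomorphicSqrt (L : HolomorphicLineBundle.{w'} E M) where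
  bundle : HolomorphicLineBundle.{w} E M
  quad : ∀ x, QuadraticMap ℂ (bundle.Fiber x) (L.Fiber x)
  surjective : ∀ x, Function.Surjective (quad x)
  holomorphic : bundle.HolomorphicMap L fun x => quad x

namespace HolomorphicSqrt

/-- An equivalence of holomorphic square roots: a holomorphic isomorphism of line bundles commuting
with the quadratic maps to `L`. -/
@[ext]
structure Hom {L : HolomorphicLineBundle.{w'} E M} (N N' : HolomorphicSqrt.{w} L) extends
    HolomorphicLineBundle.Iso N.bundle N'.bundle where
  comm : ∀ x a, N'.quad x (toEquiv x a) = N.quad x a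

/-- The category of holomorphic square roots of `L`. -/
instance {L : HolomorphicLineBundle.{w'} E M} : Category (HolomorphicSqrt.{w} L) where
  Hom := Hom
  id N := { HolomorphicLineBundle.Iso.refl N.bundle with comm := fun _ _ => rfl }
  comp φ ψ := { φ.toIso.trans ψ.toIso with
    comm := fun x a => (ψ.comm x (φ.toEquiv x a)).trans (φ.comm x a) }

/-- The functor that forgets holomorphic structures, from the holomorphic square roots of `L` with a
given holomorphic structure to the smooth square roots of `L`. -/
def forget {L : SmoothLineBundle.{w''} E M} (h : HolomorphicStructure.{w'', w'} L) :
    HolomorphicSqrt.{w} h.bundle ⥤ SmoothSqrt.{w} L where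
  obj N :=
    { bundle := N.bundle.toSmooth
      quad := fun x => (h.iso.toEquiv x).toLinearMap.compQuadraticMap (N.quad x)
      surjective := fun x => (h.iso.toEquiv x).surjective.comp (N.surjective x)
      smooth := ContMDiff.comp h.iso.smooth N.holomorphic.smoothMap }
  map φ :=
    { toEquiv := φ.toEquiv
      smooth := φ.holomorphic.smoothMap
      smooth_symm := φ.holomorphic_symm.smoothMap
      comm := fun x a => congrArg (h.iso.toEquiv x) (φ.comm x a) }

end HolomorphicSqrt

end Holomorphic

end SquareRoot

end

noncomputable section

namespace SquareRoot

open CliffordAlgebra CliffordAlgebraQuaternion Bundle CategoryTheory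

/-! ## `Spin₂` and `SO(2)` as the unit circle -/

/-! Both `Spin₂` and `SO(2)` are the unit circle in `ℂ`, with `a + b e₁e₂ ↦ a + bi` and rotation by
`θ` `↦ exp(iθ)`, and the double cover becomes `z ↦ z²` (`Spin2.toComplex_spinCover`). A map into
either group is smooth exactly when the complex function it induces is smooth. A principal circle
bundle is therefore the same thing as the bundle of unit vectors of a Hermitian line bundle; in
particular `q ↦ [q, 1]` identifies `Q` with the unit vectors of `L`.

Spin structures and Hermitian square roots. The unit vectors of a Hermitian square root `N` form a
`Spin₂`-bundle, and the quadratic map carries them to unit vectors of `L`, that is, to `Q`. The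
identity `q(za) = z² q(a)` is exactly equivariance along the double cover. Conversely `P ×_{Spin₂}
ℂ` with `[p, z] ↦ [f p, z²]` recovers a square root from `f : P → Q`. An equivariant map of unit
circles extends uniquely to a linear map of the lines, so the functor of unit vectors is fully
faithful. Smoothness is always tested on nonvanishing local sections: a fibrewise homogeneous map is
smooth once it takes one such section near each point to a smooth section
(`contMDiff_of_homogeneous`).

Forgetting the metric. Homogeneity and the condition on unit vectors force `|q(a)| = |a|²`
(`HermitianSqrt.metric_quad`). The metric of `N` is thus determined by `q`, every isomorphism
commuting with the quadratic maps is unitary, and on a bare smooth square root `|a|² = |q(a)|`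
defines the required metric.

Forgetting the holomorphic structure. A continuous square root of a nonvanishing holomorphic
function is holomorphic (`contMDiffAt_of_sq`). If a smooth isomorphism commuting with the quadratic
maps sends a holomorphic frame `s` to `c t`, then `c² = q(s)/q(t)` is holomorphic, hence so is `c`;
this gives fullness. For essential surjectivity, a frame of `N` is declared holomorphic when its
image in `L` is. Such frames exist locally by extracting a square root of a coefficient, and by the
same argument their transition functions are holomorphic. -/

/-- The identification of `Spin₂` with the unit circle: `a + b e₁ e₂` goes to `a + b i`. -/
def Spin2.toComplex (x : Spin2) : ℂ := ⟨(toQuaternion (x : Cl2)).re, (toQuaternion (x : Cl2)).imK⟩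

theorem Spin2.toQuaternion_eq (x : Spin2) : toQuaternion (x : Cl2) =
    (⟨(toComplex x).re, 0, 0, (toComplex x).im⟩ : QuaternionAlgebra ℝ (-1) 0 (-1)) := by
  obtain ⟨a, b, -, h⟩ := Spin2.exists_coord x.2
  simp [toComplex, h]

theorem Spin2.toComplex_injective : Function.Injective Spin2.toComplex := fun x y h => by
  apply Subtype.ext
  apply CliffordAlgebraQuaternion.equiv.injective
  rw [equiv_apply, equiv_apply, toQuaternion_eq, toQuaternion_eq, h]

theorem Spin2.toComplex_one : Spin2.toComplex 1 = 1 := by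
  apply Complex.ext <;> simp [toComplex]

theorem Spin2.toComplex_mul (x y : Spin2) : toComplex (x * y) = toComplex x * toComplex y := by
  obtain ⟨a, b, -, hx⟩ := Spin2.exists_coord x.2
  obtain ⟨c, d, -, hy⟩ := Spin2.exists_coord y.2
  apply Complex.ext <;> simp [toComplex, hx, hy]

theorem Spin2.conj_mul_toComplex (x : Spin2) :
    (starRingEnd ℂ) (toComplex x) * toComplex x = 1 := by
  obtain ⟨a, b, hab, h⟩ := Spin2.exists_coord x.2
  apply Complex.ext <;> simp [toComplex, h] <;> linarith

/-- The link between spin geometry and quadratic maps: the cover is squaring on the circle, as is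
the scaling `q(za) = z² q(a)`. -/
theorem Spin2.toComplex_spinCover (x : Spin2) :
    SO2.toComplex (spinCover x) = toComplex x * toComplex x := by
  obtain ⟨a, b, hab, h⟩ := Spin2.exists_coord x.2
  apply Complex.ext <;> simp [toComplex, SO2.toComplex, spinCover, conjMatrix_eq h, h] <;> ring

/-- The element `e₁ e₂` of `Cl₂`. -/
def e12 : Cl2 := ι planeForm (1, 0) * ι planeForm (0, 1)

theorem Spin2.coe_eq (x : Spin2) :
    (x : Cl2) = (toComplex x).re • (1 : Cl2) + (toComplex x).im • e12 := by
  apply CliffordAlgebraQuaternion.equiv.injective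
  rw [equiv_apply, equiv_apply, toQuaternion_eq, map_add, map_smul, map_smul, e12, map_mul, map_one]
  ext <;> simp

/-- The form is `-1` on unit vectors, so `v² = -1` and `v⁻¹ = -v = star v`. Unit vectors thus lie in
the pin group. -/
theorem isUnit_ι {v : ℝ × ℝ} (hv : v.1 ^ 2 + v.2 ^ 2 = 1) : ∃ u : Cl2ˣ, (u : Cl2) = ι planeForm v ∧
    star (u : Cl2) = (↑u⁻¹ : Cl2) := by
  have h : ι planeForm v * ι planeForm v = -1 := by
    rw [ι_sq_scalar, ← map_one (algebraMap ℝ Cl2), ← map_neg]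
    congr 1
    simp [planeForm, CliffordAlgebraQuaternion.Q_apply]
    linarith
  exact ⟨⟨ι planeForm v, -ι planeForm v, by simp [h], by simp [h]⟩, rfl, by simp⟩

theorem Spin2.exists_toComplex_eq {z : ℂ} (hz : (starRingEnd ℂ) z * z = 1) :
    ∃ x : Spin2, toComplex x = z := by
  have hz' : z.re ^ 2 + z.im ^ 2 = 1 := by
    have := congrArg Complex.re hz
    simp at this; linarith
  -- With `z = a + bi`, the product of unit vectors `e₁ (-a e₁ + b e₂) = a + b e₁e₂` is the required
  -- even element, since `e₁² = -1`.
  obtain ⟨u, hu, hu'⟩ := isUnit_ι (v := (1, 0)) (by simp)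
  obtain ⟨t, ht, ht'⟩ := isUnit_ι (v := (-z.re, z.im)) (by simpa using hz')
  have hmem : ∀ (s : Cl2ˣ) (v : ℝ × ℝ), (s : Cl2) = ι planeForm v → star (s : Cl2) = (↑s⁻¹ : Cl2) →
      (s : Cl2) ∈ pinGroup planeForm := fun s v h1 h2 => by
    refine pinGroup.mem_iff.2 ⟨?_, ?_⟩
    · exact ⟨s, Subgroup.subset_closure ⟨v, h1.symm⟩, rfl⟩
    · rw [Unitary.mem_iff, h2]; simp
  have hx : (u * t : Cl2) ∈ Spin2 := by
    refine spinGroup.mem_iff.2 ⟨mul_mem (hmem u _ hu hu') (hmem t _ ht ht'), ?_⟩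
    rw [hu, ht]
    exact ι_mul_ι_mem_evenOdd_zero planeForm _ _
  refine ⟨⟨_, hx⟩, ?_⟩
  apply Complex.ext <;> simp [toComplex, hu, ht]

theorem SO2.toComplex_injective : Function.Injective SO2.toComplex := fun A B h => by
  obtain ⟨h1, h2, -⟩ := Matrix.mem_specialOrthogonalGroup_fin_two_iff.1 A.2
  obtain ⟨h3, h4, -⟩ := Matrix.mem_specialOrthogonalGroup_fin_two_iff.1 B.2
  have hr := congrArg Complex.re h
  have hi := congrArg Complex.im h
  simp only [SO2.toComplex] at hr hi
  apply Subtype.ext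
  ext i j
  fin_cases i <;> fin_cases j <;> grind

theorem SO2.exists_toComplex_eq {z : ℂ} (hz : (starRingEnd ℂ) z * z = 1) :
    ∃ A : SO2, toComplex A = z := by
  have hz' : z.re ^ 2 + z.im ^ 2 = 1 := by
    have := congrArg Complex.re hz
    simp at this; linarith
  refine ⟨⟨!![z.re, -z.im; z.im, z.re], ?_⟩, ?_⟩
  · rw [Matrix.of_mem_specialOrthogonalGroup_fin_two_iff]
    exact ⟨rfl, rfl, by simpa using hz'⟩
  · apply Complex.ext <;> simp [SO2.toComplex]

theorem SO2.coe_eq (A : SO2) : (A : Matrix (Fin 2) (Fin 2) ℝ) =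
    (toComplex A).re • (1 : Matrix (Fin 2) (Fin 2) ℝ) + (toComplex A).im • !![0, -1; 1, 0] := by
  obtain ⟨h1, h2, -⟩ := Matrix.mem_specialOrthogonalGroup_fin_two_iff.1 A.2
  ext i j
  fin_cases i <;> fin_cases j <;> simp [toComplex] <;> grind

/-! ### Smoothness of maps into the two groups -/

section

variable {A : Type*} [Ring A] [Algebra ℝ A]
  {E : Type v} [NormedAddCommGroup E] [NormedSpace ℝ E]
  {M : Type u} [TopologicalSpace M] [ChartedSpace E M]

/-- Every linear coordinate of `f` is a real combination of the real and imaginary parts of `c`, and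
these parts are themselves the coordinates `p` and `q`. -/
theorem smoothInto_iff_of_basis {f : M → A} {s : Set M} {c : M → ℂ} (one J : A)
    (hf : ∀ x, f x = (c x).re • one + (c x).im • J) (p q : A →ₗ[ℝ] ℝ)
    (hp : ∀ x, p (f x) = (c x).re) (hq : ∀ x, q (f x) = (c x).im) :
    SmoothInto E f s ↔ ContMDiffOn 𝓘(ℝ, E) 𝓘(ℝ, ℂ) ∞ c s := by
  constructor
  · intro h
    refine (Complex.equivRealProdCLM.symm.contDiff.contMDiff.comp_contMDiffOn
      ((h p).prodMk_space (h q))).congr fun x _ => ?_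
    apply Complex.ext <;> simp [hp, hq]
  · intro h φ
    have hr := Complex.reCLM.contDiff.contMDiff.comp_contMDiffOn h
    have hi := Complex.imCLM.contDiff.contMDiff.comp_contMDiffOn h
    have := ((hr.prodMk_space hi))
    refine (ContDiff.contMDiff (f := fun p : ℝ × ℝ => p.1 * φ one + p.2 * φ J)
      (by fun_prop)).comp_contMDiffOn this |>.congr fun x _ => ?_
    simp [hf]

theorem Spin2.smoothInto_iff (g : M → Spin2) (s : Set M) :
    SmoothInto E (fun x => (g x : Cl2)) s ↔
      ContMDiffOn 𝓘(ℝ, E) 𝓘(ℝ, ℂ) ∞ (fun x => toComplex (g x)) s :=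
  smoothInto_iff_of_basis 1 e12 (fun x => coe_eq (g x))
    ({ toFun := fun y => (toQuaternion y).re
       map_add' := by simp
       map_smul' := by simp } : Cl2 →ₗ[ℝ] ℝ)
    ({ toFun := fun y => (toQuaternion y).imK
       map_add' := by simp
       map_smul' := by simp } : Cl2 →ₗ[ℝ] ℝ) (fun _ => rfl) (fun _ => rfl)

theorem SO2.smoothInto_iff (g : M → SO2) (s : Set M) :
    SmoothInto E (fun x => (g x : Matrix (Fin 2) (Fin 2) ℝ)) s ↔
      ContMDiffOn 𝓘(ℝ, E) 𝓘(ℝ, ℂ) ∞ (fun x => toComplex (g x)) s :=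
  smoothInto_iff_of_basis 1 !![0, -1; 1, 0] (fun x => coe_eq (g x))
    (Matrix.entryLinearMap ℝ ℝ 0 0) (Matrix.entryLinearMap ℝ ℝ 1 0) (fun _ => rfl) (fun _ => rfl)

end

/-! ## Sections of complex line bundles -/

section Sections

open Filter Topology

variable (𝕜 : Type*) [NontriviallyNormedField 𝕜] [NormedAlgebra 𝕜 ℂ] (n : WithTop ℕ∞)
  (E : Type v) [NormedAddCommGroup E] [NormedSpace 𝕜 E]
  {M : Type u} [TopologicalSpace M] [ChartedSpace E M]

/-! ### Square roots of functions -/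

/-- On the slit plane the principal root is `exp (log z / 2)`, which is complex analytic. The field
`𝕜` and order `n` stay general so that one argument serves the smooth case (`ℝ`, `∞`) and the
holomorphic case (`ℂ`, `ω`). -/
theorem contDiffAt_cpow_two_inv {z : ℂ} (hz : z ∈ Complex.slitPlane) :
    ContDiffAt 𝕜 n (fun z : ℂ => z ^ (2⁻¹ : ℂ)) z := by
  have : IsScalarTower 𝕜 ℂ ℂ := inferInstance
  have h : ContDiffAt ℂ n (fun z : ℂ => Complex.exp (Complex.log z * 2⁻¹)) z :=
    ((Complex.contDiffAt_log hz).mul contDiffAt_const).cexp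
  refine (h.restrict_scalars 𝕜).congr_of_eventuallyEq ?_
  filter_upwards [Complex.isOpen_slitPlane.mem_nhds hz] with y hy
  rw [Complex.cpow_def_of_ne_zero (Complex.slitPlane_ne_zero hy)]

variable {E}

/-- Dividing by `r²` rotates the branch cut away: if `r²` is a nonzero value of `f`, this formula is
a branch of the square root of `f` near the points where that value is taken. -/
theorem contMDiffAt_sqrt {f : M → ℂ} {x : M} (r : ℂ)
    (hf : ContMDiffAt 𝓘(𝕜, E) 𝓘(𝕜, ℂ) n f x) (h : f x / r ^ 2 ∈ Complex.slitPlane) :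
    ContMDiffAt 𝓘(𝕜, E) 𝓘(𝕜, ℂ) n (fun y => r * (f y / r ^ 2) ^ (2⁻¹ : ℂ)) x := by
  have h1 : ContDiffAt 𝕜 n (fun z : ℂ => r * (z / r ^ 2) ^ (2⁻¹ : ℂ)) (f x) := by
    refine contDiffAt_const.mul (ContDiffAt.comp (g := fun z : ℂ => z ^ (2⁻¹ : ℂ)) (f x)
      (contDiffAt_cpow_two_inv 𝕜 n h) ?_)
    simp only [div_eq_mul_inv]
    exact contDiffAt_id.mul contDiffAt_const
  exact h1.contMDiffAt.comp x hf

theorem sqrt_sq (z : ℂ) {r : ℂ} (hr : r ≠ 0) : (r * (z / r ^ 2) ^ (2⁻¹ : ℂ)) ^ 2 = z := by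
  have := Complex.cpow_nat_inv_pow (z / r ^ 2) (two_ne_zero)
  push_cast at this
  rw [mul_pow, this]
  field_simp

/-- A continuous square root of a nonvanishing `C^n` function is `C^n`. -/
theorem contMDiffAt_of_sq {c : M → ℂ} {x : M} (hc : ContinuousAt c x) (h0 : c x ≠ 0)
    (h : ContMDiffAt 𝓘(𝕜, E) 𝓘(𝕜, ℂ) n (fun y => c y ^ 2) x) :
    ContMDiffAt 𝓘(𝕜, E) 𝓘(𝕜, ℂ) n c x := by
  -- Take `r = c x`. Near `x` the quotient `c y / c x` has positive real part, so it is the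
  -- principal root of its own square and the branch agrees with `c`.
  refine (contMDiffAt_sqrt 𝕜 n (c x) h ?_).congr_of_eventuallyEq ?_
  · rw [div_self (pow_ne_zero 2 h0)]; simp
  · have h1 : ContinuousAt (fun y => (c y / c x).re) x :=
      Complex.continuous_re.continuousAt.comp (hc.div_const _)
    have h2 : 0 < (c x / c x).re := by simp [div_self h0]
    filter_upwards [h1.eventually (lt_mem_nhds h2)] with y hy
    rw [← div_pow, Complex.sq_cpow_two_inv hy]
    field_simp

/-! ### Sections of line bundles -/

variable (E)
variable {V : M → Type w} [TopologicalSpace (TotalSpace ℂ V)] [∀ x, TopologicalSpace (V x)]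
  {V' : M → Type w'} [TopologicalSpace (TotalSpace ℂ V')] [∀ x, TopologicalSpace (V' x)]
  [FiberBundle ℂ V] [FiberBundle ℂ V']

/-- The section `s` is of class `C^n` at `x₀`. -/
def SectionAt (s : ∀ x, V x) (x₀ : M) : Prop :=
  ContMDiffAt 𝓘(𝕜, E) (𝓘(𝕜, E).prod 𝓘(𝕜, ℂ)) n (fun x => TotalSpace.mk' ℂ x (s x)) x₀

variable {𝕜 n E}

theorem SectionAt.congr {s s' : ∀ x, V x} {x₀ : M} (h : SectionAt 𝕜 n E s x₀)
    (hs : ∀ᶠ x in 𝓝 x₀, s' x = s x) : SectionAt 𝕜 n E s' x₀ :=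
  ContMDiffAt.congr_of_eventuallyEq h (hs.mono fun x hx => by simp only [hx])

theorem SectionAt.map {f : ∀ x, V x → V' x}
    (hf : ContMDiff (𝓘(𝕜, E).prod 𝓘(𝕜, ℂ)) (𝓘(𝕜, E).prod 𝓘(𝕜, ℂ)) n
      fun p : TotalSpace ℂ V => TotalSpace.mk' ℂ p.proj (f p.proj p.2))
    {s : ∀ x, V x} {x₀ : M} (hs : SectionAt 𝕜 n E s x₀) :
    SectionAt 𝕜 n E (fun x => f x (s x)) x₀ :=
  ContMDiffAt.comp (f := fun x => TotalSpace.mk' ℂ x (s x)) x₀ hf.contMDiffAt hs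

variable [∀ x, AddCommGroup (V x)] [∀ x, AddCommGroup (V' x)]

section

variable [∀ x, Module 𝕜 (V x)] [VectorBundle 𝕜 ℂ V] [ContMDiffVectorBundle n ℂ V 𝓘(𝕜, E)]

theorem sectionAt_iff {s : ∀ x, V x} {x₀ : M} (e : Trivialization ℂ (π ℂ V))
    [MemTrivializationAtlas e] (hx : x₀ ∈ e.baseSet) :
    SectionAt 𝕜 n E s x₀ ↔ ContMDiffAt 𝓘(𝕜, E) 𝓘(𝕜, ℂ) n (fun x => (e ⟨x, s x⟩).2) x₀ :=
  e.contMDiffAt_section_iff hx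

theorem sectionAt_frame (e : Trivialization ℂ (π ℂ V)) [MemTrivializationAtlas e] {x₀ : M}
    (hx : x₀ ∈ e.baseSet) (z : ℂ) : SectionAt 𝕜 n E (fun x => e.symm x z : ∀ x, V x) x₀ := by
  rw [sectionAt_iff e hx]
  refine (contMDiffAt_const (c := z)).congr_of_eventuallyEq ?_
  filter_upwards [e.open_baseSet.mem_nhds hx] with y hy
  rw [e.apply_mk_symm hy]

end

variable [∀ x, Module ℂ (V x)] [VectorBundle ℂ ℂ V]

theorem symm_one_ne_zero (e : Trivialization ℂ (π ℂ V)) [MemTrivializationAtlas e] {x : M}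
    (hx : x ∈ e.baseSet) : e.symm x 1 ≠ 0 := fun h => by
  have h1 := e.apply_mk_symm hx (1 : ℂ)
  rw [h] at h1
  have h2 := (e.linear ℂ hx).map_zero
  rw [h1] at h2
  exact one_ne_zero h2

theorem coord_smul (e : Trivialization ℂ (π ℂ V)) [MemTrivializationAtlas e] {x : M}
    (hx : x ∈ e.baseSet) (z : ℂ) (a : V x) : (e ⟨x, z • a⟩).2 = z * (e ⟨x, a⟩).2 :=
  (e.linear ℂ hx).map_smul z a

theorem eq_coord_smul (e : Trivialization ℂ (π ℂ V)) [MemTrivializationAtlas e] {x : M}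
    (hx : x ∈ e.baseSet) (a : V x) : a = (e ⟨x, a⟩).2 • e.symm x (1 : ℂ) := by
  have h1 := e.symm_apply_apply_mk hx a
  conv_lhs => rw [← h1]
  have h2 := (e.symmₗ ℂ x).map_smul (e ⟨x, a⟩).2 (1 : ℂ)
  rw [e.coe_symmₗ hx] at h2
  rw [← h2, smul_eq_mul, mul_one]

theorem coord_ne_zero (e : Trivialization ℂ (π ℂ V)) [MemTrivializationAtlas e] {x : M}
    (hx : x ∈ e.baseSet) {a : V x} (ha : a ≠ 0) : (e ⟨x, a⟩).2 ≠ 0 := fun h => ha <| by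
  rw [eq_coord_smul e hx a, h, zero_smul]

/-- The fibres are one-dimensional; the scalar is the quotient of the coordinates in a
trivialization. -/
theorem exists_smul_eq {x : M} {a : V x} (ha : a ≠ 0) (b : V x) : ∃ z : ℂ, b = z • a := by
  let e := trivializationAt ℂ V x
  have hx := mem_baseSet_trivializationAt ℂ V x
  refine ⟨(e ⟨x, b⟩).2 / (e ⟨x, a⟩).2, (eq_coord_smul e hx b).trans ?_⟩
  refine Eq.trans ?_ (congrArg _ (eq_coord_smul e hx a).symm)
  rw [smul_smul, div_mul_cancel₀ _ (coord_ne_zero e hx ha)]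

variable [∀ x, Module 𝕜 (V x)] [VectorBundle 𝕜 ℂ V] [ContMDiffVectorBundle n ℂ V 𝓘(𝕜, E)]

theorem SectionAt.smul {s : ∀ x, V x} {c : M → ℂ} {x₀ : M} (hs : SectionAt 𝕜 n E s x₀)
    (hc : ContMDiffAt 𝓘(𝕜, E) 𝓘(𝕜, ℂ) n c x₀) : SectionAt 𝕜 n E (fun x => c x • s x) x₀ := by
  have hx := mem_baseSet_trivializationAt ℂ V x₀
  rw [sectionAt_iff (trivializationAt ℂ V x₀) hx] at hs ⊢
  have h : ContMDiffAt 𝓘(𝕜, E) 𝓘(𝕜, ℂ) n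
      (fun x => c x * (trivializationAt ℂ V x₀ ⟨x, s x⟩).2) x₀ :=
    (contDiff_mul (𝕜 := 𝕜) (𝔸 := ℂ)).contMDiff.contMDiffAt.comp x₀ (hc.prodMk_space hs)
  refine h.congr_of_eventuallyEq ?_
  filter_upwards [(trivializationAt ℂ V x₀).open_baseSet.mem_nhds hx] with y hy
  rw [coord_smul _ hy]

/-- The source is an arbitrary manifold because the quotient is also taken on the total space of a
line bundle. -/
theorem contMDiffAt_div {N : Type*} [TopologicalSpace N] {H E' : Type*} [TopologicalSpace H]
    [NormedAddCommGroup E'] [NormedSpace 𝕜 E'] {I : ModelWithCorners 𝕜 E' H} [ChartedSpace H N]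
    {f g : N → ℂ} {x : N} (hf : ContMDiffAt I 𝓘(𝕜, ℂ) n f x) (hg : ContMDiffAt I 𝓘(𝕜, ℂ) n g x)
    (h0 : g x ≠ 0) : ContMDiffAt I 𝓘(𝕜, ℂ) n (fun y => f y / g y) x := by
  have h : ContDiffAt 𝕜 n (fun p : ℂ × ℂ => p.1 * p.2⁻¹) (f x, g x) :=
    contDiffAt_fst.mul (contDiffAt_snd.inv h0)
  exact h.contMDiffAt.comp x (hf.prodMk_space hg)

theorem SectionAt.eventually_ne {s : ∀ x, V x} {x₀ : M} (hs : SectionAt 𝕜 n E s x₀)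
    (h0 : s x₀ ≠ 0) : ∀ᶠ x in 𝓝 x₀, s x ≠ 0 := by
  have hx := mem_baseSet_trivializationAt ℂ V x₀
  rw [sectionAt_iff (trivializationAt ℂ V x₀) hx] at hs
  filter_upwards [(trivializationAt ℂ V x₀).open_baseSet.mem_nhds hx,
    hs.continuousAt.eventually_ne (coord_ne_zero _ hx h0)] with y hy h1 h2
  rw [h2] at h1
  exact h1 ((trivializationAt ℂ V x₀).linear ℂ hy).map_zero

/-- In a trivialization `c` is the quotient of the coordinates of `s` and `t`. Every comparison of
local frames below rests on this. -/
theorem SectionAt.coeff {s t : ∀ x, V x} {c : M → ℂ} {x₀ : M} (hs : SectionAt 𝕜 n E s x₀)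
    (ht : SectionAt 𝕜 n E t x₀) (h0 : t x₀ ≠ 0) (h : ∀ᶠ x in 𝓝 x₀, s x = c x • t x) :
    ContMDiffAt 𝓘(𝕜, E) 𝓘(𝕜, ℂ) n c x₀ := by
  have h1 := ht.eventually_ne h0
  have hx := mem_baseSet_trivializationAt ℂ V x₀
  rw [sectionAt_iff (trivializationAt ℂ V x₀) hx] at hs ht
  refine (contMDiffAt_div hs ht (coord_ne_zero _ hx h0)).congr_of_eventuallyEq ?_
  filter_upwards [(trivializationAt ℂ V x₀).open_baseSet.mem_nhds hx, h, h1] with y hy h2 h3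
  rw [h2, coord_smul _ hy, mul_div_cancel_right₀ _ (coord_ne_zero _ hy h3)]

variable [∀ x, Module ℂ (V' x)] [∀ x, Module 𝕜 (V' x)]
  [VectorBundle ℂ ℂ V'] [VectorBundle 𝕜 ℂ V'] [ContMDiffVectorBundle n ℂ V' 𝓘(𝕜, E)]

/-- A map over `M` between line bundles that is homogeneous on each fibre is `C^n` if it sends
nonvanishing `C^n` sections near every point to `C^n` sections. -/
theorem contMDiff_of_homogeneous (f : ∀ x, V x → V' x) (k : ℕ)
    (hf : ∀ x (z : ℂ) a, f x (z • a) = z ^ k • f x a)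
    (h : ∀ x₀, ∃ s : ∀ x, V x, SectionAt 𝕜 n E s x₀ ∧ s x₀ ≠ 0 ∧
      SectionAt 𝕜 n E (fun x => f x (s x)) x₀) :
    ContMDiff (𝓘(𝕜, E).prod 𝓘(𝕜, ℂ)) (𝓘(𝕜, E).prod 𝓘(𝕜, ℂ)) n
      fun p : TotalSpace ℂ V => TotalSpace.mk' ℂ p.proj (f p.proj p.2) := by
  rintro ⟨x₀, a₀⟩
  obtain ⟨s, hs, h0, hfs⟩ := h x₀
  have h1 := hs.eventually_ne h0
  set e := trivializationAt ℂ V x₀ with he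
  set e' := trivializationAt ℂ V' x₀ with he'
  have hx : x₀ ∈ e.baseSet := mem_baseSet_trivializationAt ℂ V x₀
  have hx' : x₀ ∈ e'.baseSet := mem_baseSet_trivializationAt ℂ V' x₀
  rw [sectionAt_iff e hx] at hs
  rw [sectionAt_iff e' hx'] at hfs
  have hp : ContMDiffAt (𝓘(𝕜, E).prod 𝓘(𝕜, ℂ)) 𝓘(𝕜, E) n (π ℂ V) ⟨x₀, a₀⟩ := contMDiffAt_proj V
  rw [e'.contMDiffAt_iff (by simpa [e'.mem_source] using hx')]
  refine ⟨hp, ?_⟩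
  have hid : ContMDiffAt (𝓘(𝕜, E).prod 𝓘(𝕜, ℂ)) (𝓘(𝕜, E).prod 𝓘(𝕜, ℂ)) n
    (id : TotalSpace ℂ V → TotalSpace ℂ V) ⟨x₀, a₀⟩ := contMDiffAt_id
  rw [e.contMDiffAt_iff (by simpa [e.mem_source] using hx)] at hid
  have h2 := ContMDiffAt.comp (g := fun x => (e ⟨x, s x⟩).2) (⟨x₀, a₀⟩ : TotalSpace ℂ V) hs hp
  have h3 := ContMDiffAt.comp (g := fun x => (e' ⟨x, f x (s x)⟩).2)
    (⟨x₀, a₀⟩ : TotalSpace ℂ V) hfs hp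
  -- A vector over `x` is `z • s x`, where `z` is its coordinate divided by that of `s x`;
  -- homogeneity then gives its image as `z ^ k • f x (s x)`. Additivity of `f` plays no part, so
  -- linear and quadratic maps are both covered.
  have h4 := contMDiffAt_div hid.2 h2 (coord_ne_zero e hx h0)
  have h5 : ContDiff 𝕜 n (fun p : ℂ × ℂ => p.1 ^ k * p.2) := by fun_prop
  refine (h5.contMDiff.contMDiffAt.comp _ (h4.prodMk_space h3)).congr_of_eventuallyEq ?_
  have hcont := hp.continuousAt
  filter_upwards [hcont.eventually (e.open_baseSet.mem_nhds hx),
    hcont.eventually (e'.open_baseSet.mem_nhds hx'), hcont.eventually h1] with p hp1 hp2 hp3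
  obtain ⟨x, a⟩ := p
  have hp4 : s x ≠ 0 := hp3
  obtain ⟨z, rfl⟩ := exists_smul_eq hp4 a
  change (e' ⟨x, f x (z • s x)⟩).2 =
    ((e ⟨x, z • s x⟩).2 / (e ⟨x, s x⟩).2) ^ k * (e' ⟨x, f x (s x)⟩).2
  rw [coord_smul e hp1, mul_div_cancel_right₀ _ (coord_ne_zero e hp1 hp4), hf, coord_smul e' hp2]

end Sections

/-! ## Line bundles from local frames -/

section Construction

open Filter Topology

open Classical in
/-- The extension of a local section by zero. -/
def LocalSection.extend {M : Type u} [TopologicalSpace M] {V : M → Type w} [∀ x, AddCommGroup (V x)]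
    (σ : LocalSection V) (x : M) : V x :=
  if h : x ∈ σ.domain then σ.toFun x h else 0

theorem LocalSection.extend_of_mem {M : Type u} [TopologicalSpace M] {V : M → Type w}
    [∀ x, AddCommGroup (V x)] (σ : LocalSection V) {x : M} (h : x ∈ σ.domain) :
    σ.extend x = σ.toFun x h :=
  dif_pos h

variable (𝕜 : Type*) [NontriviallyNormedField 𝕜] [NormedAlgebra 𝕜 ℂ] (n : WithTop ℕ∞)
  (E : Type v) [NormedAddCommGroup E] [NormedSpace 𝕜 E]
  {M : Type u} [TopologicalSpace M] [ChartedSpace E M]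

/-- A family of local frames, with `C^n` transition functions, of a family of complex lines. -/
structure FrameAtlas (V : M → Type w) [∀ x, AddCommGroup (V x)] [∀ x, Module ℂ (V x)] where
  frames : Set (LocalSection V)
  existsUnique_smul : ∀ σ ∈ frames, ∀ x (h : x ∈ σ.domain) (a : V x), ∃! z : ℂ, z • σ.toFun x h = a
  exists_mem : ∀ x, ∃ σ ∈ frames, x ∈ σ.domain
  contMDiffOn : ∀ σ ∈ frames, ∀ τ ∈ frames, ∃ c : M → ℂ,
    ContMDiffOn 𝓘(𝕜, E) 𝓘(𝕜, ℂ) n c (σ.domain ∩ τ.domain : Set M) ∧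
      ∀ x (hσ : x ∈ σ.domain) (hτ : x ∈ τ.domain), σ.toFun x hσ = c x • τ.toFun x hτ

namespace FrameAtlas

variable {𝕜 n E} {V : M → Type w} [∀ x, AddCommGroup (V x)] [∀ x, Module ℂ (V x)]
  (A : FrameAtlas 𝕜 n E V)

open Classical in
/-- The coordinate of a vector in a local frame. -/
def coord (σ : LocalSection V) (x : M) (a : V x) : ℂ :=
  if h : ∃ z : ℂ, z • σ.extend x = a then h.choose else 0

variable {A}

theorem coord_smul_frame {σ : LocalSection V} (hσ : σ ∈ A.frames) {x : M} (h : x ∈ σ.domain)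
    (a : V x) : coord σ x a • σ.extend x = a := by
  have h1 : ∃ z : ℂ, z • σ.extend x = a := by
    rw [σ.extend_of_mem h]; exact (A.existsUnique_smul σ hσ x h a).exists
  rw [coord, dif_pos h1]
  exact h1.choose_spec

theorem coord_unique {σ : LocalSection V} (hσ : σ ∈ A.frames) {x : M} (h : x ∈ σ.domain)
    {a : V x} {z : ℂ} (hz : z • σ.extend x = a) : coord σ x a = z := by
  have h1 := coord_smul_frame hσ h a
  rw [σ.extend_of_mem h] at h1 hz
  exact (A.existsUnique_smul σ hσ x h a).unique h1 hz

variable (A)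

/-- The local trivialization given by a local frame. -/
def pretrivialization (σ : A.frames) : Pretrivialization ℂ (π ℂ V) where
  toFun p := (p.1, coord σ.1 p.1 p.2)
  invFun p := ⟨p.1, p.2 • σ.1.extend p.1⟩
  source := π ℂ V ⁻¹' σ.1.domain
  target := (σ.1.domain : Set M) ×ˢ Set.univ
  map_source' p hp := ⟨hp, trivial⟩
  map_target' p hp := hp.1
  left_inv' := by
    rintro ⟨x, a⟩ hx
    exact congrArg (TotalSpace.mk x) (coord_smul_frame σ.2 hx a)
  right_inv' := by
    rintro ⟨x, z⟩ hx
    exact congrArg (Prod.mk x) (coord_unique σ.2 hx.1 rfl)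
  open_target := σ.1.domain.isOpen.prod isOpen_univ
  baseSet := σ.1.domain
  open_baseSet := σ.1.domain.isOpen
  source_eq := rfl
  target_eq := rfl
  proj_toFun _ _ := rfl

theorem pretrivialization_symm (σ : A.frames) {x : M} (h : x ∈ σ.1.domain) (z : ℂ) :
    (A.pretrivialization σ).symm x z = z • σ.1.extend x := by
  have : x ∈ (A.pretrivialization σ).baseSet := h
  rw [Pretrivialization.symm_apply _ this]
  rfl

/-- A local frame on a neighbourhood of a point. -/
def frameAt (x : M) : A.frames := ⟨(A.exists_mem x).choose, (A.exists_mem x).choose_spec.1⟩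

theorem mem_frameAt (x : M) : x ∈ (A.frameAt x).1.domain := (A.exists_mem x).choose_spec.2

/-- The topology of a fibre. -/
@[reducible]
def topFiber (x : M) : TopologicalSpace (V x) :=
  .induced (fun a => A.pretrivialization (A.frameAt x) ⟨x, a⟩) inferInstance

/-- The vector prebundle given by the local frames. -/
def prebundle : letI := A.topFiber; VectorPrebundle ℂ ℂ V :=
  letI := A.topFiber
  { pretrivializationAtlas := Set.range A.pretrivialization
    pretrivialization_linear' := by
      rintro _ ⟨σ, rfl⟩
      refine ⟨fun x hx => ⟨fun a b => ?_, fun z a => ?_⟩⟩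
      · refine coord_unique σ.2 hx ?_
        rw [add_smul]
        exact congrArg₂ _ (coord_smul_frame σ.2 hx a) (coord_smul_frame σ.2 hx b)
      · refine coord_unique σ.2 hx ?_
        rw [smul_assoc]
        exact congrArg _ (coord_smul_frame σ.2 hx a)
    pretrivializationAt := fun x => A.pretrivialization (A.frameAt x)
    mem_base_pretrivializationAt := A.mem_frameAt
    pretrivialization_mem_atlas := fun x => ⟨_, rfl⟩
    exists_coordChange := by
      rintro _ ⟨σ, rfl⟩ _ ⟨τ, rfl⟩
      obtain ⟨c, hc, h⟩ := A.contMDiffOn σ.1 σ.2 τ.1 τ.2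
      refine ⟨fun x => c x • ContinuousLinearMap.id ℂ ℂ,
        hc.continuousOn.smul continuousOn_const, ?_⟩
      rintro x ⟨hσ, hτ⟩ z
      rw [A.pretrivialization_symm σ hσ]
      refine (coord_unique τ.2 hτ ?_).symm
      rw [σ.1.extend_of_mem hσ, τ.1.extend_of_mem hτ, h x hσ hτ, smul_smul, mul_comm z]
      rfl
    -- The fibre topology was defined as the one induced by this very trivialization.
    totalSpaceMk_isInducing := fun x => ⟨rfl⟩ }

/-- The topology of the total space. -/
@[reducible]
def topTotal : TopologicalSpace (TotalSpace ℂ V) :=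
  letI := A.topFiber; A.prebundle.totalSpaceTopology

@[reducible]
def fiberBundle : letI := A.topFiber; letI := A.topTotal; FiberBundle ℂ V :=
  letI := A.topFiber; letI := A.topTotal; A.prebundle.toFiberBundle

theorem vectorBundle : letI := A.topFiber; letI := A.topTotal; letI := A.fiberBundle;
    VectorBundle ℂ ℂ V :=
  letI := A.topFiber; letI := A.topTotal; A.prebundle.toVectorBundle

theorem exists_trivialization (σ : A.frames) : letI := A.topFiber; letI := A.topTotal;
    letI := A.fiberBundle; ∃ e : Trivialization ℂ (π ℂ V), MemTrivializationAtlas e ∧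
      e.baseSet = σ.1.domain ∧ (∀ p, e p = (p.1, coord σ.1 p.1 p.2)) :=
  letI := A.topFiber; letI := A.topTotal; letI := A.fiberBundle
  ⟨A.prebundle.trivializationOfMemPretrivializationAtlas ⟨σ, rfl⟩, ⟨⟨_, ⟨σ, rfl⟩, rfl⟩⟩, rfl,
    fun _ => rfl⟩

/-- The converse of `exists_trivialization`: the frames exhaust the trivialization atlas, so
smoothness of the bundle need only be checked between frames. -/
theorem mem_atlas (e : letI := A.topTotal; Trivialization ℂ (π ℂ V)) :
    letI := A.topFiber; letI := A.topTotal;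
    letI := A.fiberBundle; MemTrivializationAtlas e → ∃ σ : A.frames,
      e.baseSet = σ.1.domain ∧ (∀ p, e p = (p.1, coord σ.1 p.1 p.2)) := by
  intro he
  obtain ⟨_, ⟨σ, rfl⟩, rfl⟩ := he.1
  exact ⟨σ, rfl, fun _ => rfl⟩

/-- The coordinate change from `σ` to `τ` is multiplication by the transition function `c`. The
`𝕜`-linear structure is a separate argument because in the smooth case it is the real structure
underlying the complex one. -/
theorem contMDiffVectorBundle [∀ x, Module 𝕜 (V x)] : letI := A.topFiber; letI := A.topTotal;
    letI := A.fiberBundle; ∀ [VectorBundle 𝕜 ℂ V], ContMDiffVectorBundle n ℂ V 𝓘(𝕜, E) := by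
  let := A.topFiber; let := A.topTotal; let := A.fiberBundle
  intro _
  refine ⟨fun e e' he he' => ?_⟩
  obtain ⟨σ, hσ, hσ'⟩ := A.mem_atlas e he
  obtain ⟨τ, hτ, hτ'⟩ := A.mem_atlas e' he'
  obtain ⟨c, hc, h⟩ := A.contMDiffOn σ.1 σ.2 τ.1 τ.2
  rw [hσ, hτ]
  refine ((ContinuousLinearMap.mul 𝕜 ℂ).contMDiff.comp_contMDiffOn hc).congr fun x hx =>
    ContinuousLinearMap.ext fun z => ?_
  have hxe : x ∈ e.baseSet ∩ e'.baseSet := by rw [hσ, hτ]; exact hx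
  refine (Trivialization.coordChangeL_apply (R := 𝕜) e e' hxe z).trans ?_
  have h1 : coord σ.1 x (e.symm x z) = z := by
    have := congrArg Prod.snd (e.apply_mk_symm hxe.1 z)
    rwa [hσ'] at this
  have h2 := coord_smul_frame σ.2 hx.1 (e.symm x z)
  rw [h1] at h2
  rw [hτ']
  refine coord_unique τ.2 hx.2 ?_
  rw [← h2, σ.1.extend_of_mem hx.1, τ.1.extend_of_mem hx.2, h x hx.1 hx.2, smul_smul, mul_comm z]
  rfl

/-- In the trivialization that it defines, a frame has constant coordinate `1`. -/
theorem sectionAt_extend [∀ x, Module 𝕜 (V x)] {σ : LocalSection V} (hσ : σ ∈ A.frames) {x : M}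
    (hx : x ∈ σ.domain) : letI := A.topFiber; letI := A.topTotal; letI := A.fiberBundle;
    ∀ [VectorBundle 𝕜 ℂ V], SectionAt 𝕜 n E σ.extend x := by
  let := A.topFiber; let := A.topTotal; let := A.fiberBundle
  intro _
  have := A.contMDiffVectorBundle
  obtain ⟨e, he, h1, h2⟩ := A.exists_trivialization ⟨σ, hσ⟩
  rw [sectionAt_iff e (by rw [h1]; exact hx)]
  refine (contMDiffAt_const (c := 1)).congr_of_eventuallyEq ?_
  filter_upwards [σ.domain.isOpen.mem_nhds hx] with y hy
  rw [h2]
  exact coord_unique hσ hy (one_smul _ _)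

/-- The smooth line bundle given by the local frames. -/
def toSmooth {E : Type v} [NormedAddCommGroup E] [NormedSpace ℝ E] {M : Type u}
    [TopologicalSpace M] [ChartedSpace E M] {V : M → Type w} [∀ x, AddCommGroup (V x)]
    [∀ x, Module ℂ (V x)] (A : FrameAtlas ℝ ∞ E V) : SmoothLineBundle.{w} E M :=
  letI := A.topFiber; letI := A.topTotal; letI := A.fiberBundle
  letI := A.vectorBundle
  { Fiber := V
    smooth := A.contMDiffVectorBundle }

/-- The holomorphic line bundle given by the local frames. -/
def toHolomorphic {E : Type v} [NormedAddCommGroup E] [NormedSpace ℂ E] {M : Type u}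
    [TopologicalSpace M] [ChartedSpace E M] {V : M → Type w} [∀ x, AddCommGroup (V x)]
    [∀ x, Module ℂ (V x)] (A : FrameAtlas ℂ ω E V) : HolomorphicLineBundle.{w} E M :=
  letI := A.topFiber; letI := A.topTotal; letI := A.fiberBundle
  letI := A.vectorBundle
  { Fiber := V
    holomorphic := A.contMDiffVectorBundle }

end FrameAtlas

/-- The section `s` of a smooth line bundle is smooth at `x`. -/
abbrev SmoothLineBundle.SmoothAt {E : Type v} [NormedAddCommGroup E] [NormedSpace ℝ E] {M : Type u}
    [TopologicalSpace M] [ChartedSpace E M] (N : SmoothLineBundle.{w} E M) (s : ∀ x, N.Fiber x)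
    (x : M) : Prop :=
  SectionAt ℝ ∞ E s x

/-- The section `s` of a holomorphic line bundle is holomorphic at `x`. -/
abbrev HolomorphicLineBundle.HolomorphicAt {E : Type v} [NormedAddCommGroup E] [NormedSpace ℂ E]
    {M : Type u} [TopologicalSpace M] [ChartedSpace E M] (N : HolomorphicLineBundle.{w} E M)
    (s : ∀ x, N.Fiber x) (x : M) : Prop :=
  SectionAt ℂ ω E s x

theorem FrameAtlas.smoothAt_extend {E : Type v} [NormedAddCommGroup E] [NormedSpace ℝ E] {M : Type u}
    [TopologicalSpace M] [ChartedSpace E M] {V : M → Type w} [∀ x, AddCommGroup (V x)]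
    [∀ x, Module ℂ (V x)] (A : FrameAtlas ℝ ∞ E V) {σ : LocalSection V} (hσ : σ ∈ A.frames) {x : M}
    (hx : x ∈ σ.domain) : A.toSmooth.SmoothAt σ.extend x :=
  letI := A.topFiber; letI := A.topTotal; letI := A.fiberBundle
  letI := A.vectorBundle
  A.sectionAt_extend hσ hx

theorem FrameAtlas.holomorphicAt_extend {E : Type v} [NormedAddCommGroup E] [NormedSpace ℂ E]
    {M : Type u} [TopologicalSpace M] [ChartedSpace E M] {V : M → Type w} [∀ x, AddCommGroup (V x)]
    [∀ x, Module ℂ (V x)] (A : FrameAtlas ℂ ω E V) {σ : LocalSection V} (hσ : σ ∈ A.frames) {x : M}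
    (hx : x ∈ σ.domain) : A.toHolomorphic.HolomorphicAt σ.extend x :=
  letI := A.topFiber; letI := A.topTotal; letI := A.fiberBundle
  letI := A.vectorBundle
  A.sectionAt_extend hσ hx

end Construction

/-! ## Hermitian metrics and the functor that forgets them -/

section Metric

open Filter Topology

variable {E : Type v} [NormedAddCommGroup E] [NormedSpace ℝ E]
  {M : Type u} [TopologicalSpace M] [ChartedSpace E M]

theorem SmoothLineBundle.exists_frame (N : SmoothLineBundle.{w} E M) (x : M) :
    ∃ s : ∀ x, N.Fiber x, N.SmoothAt s x ∧ s x ≠ 0 := by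
  let e := trivializationAt ℂ N.Fiber x
  have hx := mem_baseSet_trivializationAt ℂ N.Fiber x
  exact ⟨fun x => e.symm x 1, sectionAt_frame e hx 1, symm_one_ne_zero e hx⟩

theorem SmoothLineBundle.exists_coeff {N : SmoothLineBundle.{w} E M} {s t : ∀ x, N.Fiber x} {x : M}
    (hs : N.SmoothAt s x) (ht : N.SmoothAt t x) (h0 : t x ≠ 0) :
    ∃ c : M → ℂ, ContMDiffAt 𝓘(ℝ, E) 𝓘(ℝ, ℂ) ∞ c x ∧ ∀ᶠ y in 𝓝 x, s y = c y • t y := by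
  have h1 : ∀ y, ∃ z : ℂ, t y ≠ 0 → s y = z • t y := fun y => by
    by_cases hy : t y = 0
    · exact ⟨0, fun h => absurd hy h⟩
    · exact (exists_smul_eq hy (s y)).imp fun _ h _ => h
  choose c hc using h1
  have h2 : ∀ᶠ y in 𝓝 x, s y = c y • t y := (SectionAt.eventually_ne ht h0).mono hc
  exact ⟨c, SectionAt.coeff hs ht h0 h2, h2⟩

/-- On a line, one diagonal value determines a sesquilinear form: if `s = c u` and `t = d u`, then
`m(s, t) = conj(c) d m(u, u)`. -/
theorem contMDiffAt_metric {N : SmoothLineBundle.{w} E M}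
    (m : ∀ x, N.Fiber x →ₗ⋆[ℂ] N.Fiber x →ₗ[ℂ] ℂ) {u : ∀ x, N.Fiber x} {x : M}
    (hu : N.SmoothAt u x) (h0 : u x ≠ 0)
    (hm : ContMDiffAt 𝓘(ℝ, E) 𝓘(ℝ, ℂ) ∞ (fun x => m x (u x) (u x)) x) {s t : ∀ x, N.Fiber x}
    (hs : N.SmoothAt s x) (ht : N.SmoothAt t x) :
    ContMDiffAt 𝓘(ℝ, E) 𝓘(ℝ, ℂ) ∞ (fun x => m x (s x) (t x)) x := by
  obtain ⟨c, hc, hc'⟩ := SmoothLineBundle.exists_coeff hs hu h0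
  obtain ⟨d, hd, hd'⟩ := SmoothLineBundle.exists_coeff ht hu h0
  have h : ContDiff ℝ ∞ (fun p : ℂ × ℂ × ℂ => (starRingEnd ℂ) p.1 * (p.2.1 * p.2.2)) := by
    have h1 : ContDiff ℝ ∞ (starRingEnd ℂ) := Complex.conjCLE.contDiff
    exact (h1.comp contDiff_fst).mul (by fun_prop)
  refine (h.contMDiff.contMDiffAt.comp x
    (hc.prodMk_space (hd.prodMk_space hm))).congr_of_eventuallyEq ?_
  filter_upwards [hc', hd'] with y h1 h2
  simp [h1, h2, mul_left_comm]

theorem HermitianLineBundle.contMDiffAt_metric (N : HermitianLineBundle.{w} E M) {x : M}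
    {s t : ∀ x, N.Fiber x} (hs : N.SmoothAt s x) (ht : N.SmoothAt t x) :
    ContMDiffAt 𝓘(ℝ, E) 𝓘(ℝ, ℂ) ∞ (fun x => N.metric x (s x) (t x)) x := by
  let e := trivializationAt ℂ N.Fiber x
  have hx := mem_baseSet_trivializationAt ℂ N.Fiber x
  exact SquareRoot.contMDiffAt_metric N.metric (sectionAt_frame e hx 1) (symm_one_ne_zero e hx)
    ((N.smooth_metric e 1 1).contMDiffAt (e.open_baseSet.mem_nhds hx)) hs ht

theorem contMDiffOn_metric {N : SmoothLineBundle.{w} E M}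
    (m : ∀ x, N.Fiber x →ₗ⋆[ℂ] N.Fiber x →ₗ[ℂ] ℂ)
    (h : ∀ x, ∃ s : ∀ x, N.Fiber x, N.SmoothAt s x ∧ s x ≠ 0 ∧
      ContMDiffAt 𝓘(ℝ, E) 𝓘(ℝ, ℂ) ∞ (fun x => m x (s x) (s x)) x)
    (e : Trivialization ℂ (π ℂ N.Fiber)) [MemTrivializationAtlas e] (a b : ℂ) :
    ContMDiffOn 𝓘(ℝ, E) 𝓘(ℝ, ℂ) ∞ (fun x => m x (e.symm x a) (e.symm x b)) e.baseSet := by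
  intro x hx
  obtain ⟨s, hs, h0, hm⟩ := h x
  exact (contMDiffAt_metric m hs h0 hm (sectionAt_frame e hx a)
    (sectionAt_frame e hx b)).contMDiffWithinAt

namespace HermitianLineBundle

variable (N : HermitianLineBundle.{w} E M)

theorem metric_self (x : M) (a : N.Fiber x) : N.metric x a a = ((N.metric x a a).re : ℂ) :=
  (Complex.conj_eq_iff_re.1 (N.conj_symm x a a)).symm

theorem metric_self_nonneg (x : M) (a : N.Fiber x) : 0 ≤ (N.metric x a a).re := by
  by_cases ha : a = 0
  · simp [ha]
  · exact (N.pos x a ha).le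

theorem metric_smul_self (x : M) (z : ℂ) (a : N.Fiber x) :
    N.metric x (z • a) (z • a) = (starRingEnd ℂ) z * z * N.metric x a a := by
  simp [mul_left_comm, mul_assoc]

theorem metric_smul_self_re (x : M) (z : ℂ) (a : N.Fiber x) :
    (N.metric x (z • a) (z • a)).re = Complex.normSq z * (N.metric x a a).re := by
  rw [metric_smul_self, ← Complex.normSq_eq_conj_mul_self, Complex.re_ofReal_mul]

theorem metric_eq_one_iff (x : M) (a : N.Fiber x) :
    N.metric x a a = 1 ↔ (N.metric x a a).re = 1 := by
  constructor
  · intro h; rw [h, Complex.one_re]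
  · intro h; rw [N.metric_self, h, Complex.ofReal_one]

theorem ne_zero_of_metric_eq_one {x : M} {a : N.Fiber x} (h : N.metric x a a = 1) : a ≠ 0 := by
  rintro rfl
  simp at h

/-- Every nonzero vector is a positive multiple of a unit vector. -/
theorem exists_unit_smul {x : M} {a : N.Fiber x} (ha : a ≠ 0) :
    ∃ (t : ℝ) (b : N.Fiber x), 0 < t ∧ N.metric x b b = 1 ∧ a = (t : ℂ) • b := by
  have h := N.pos x a ha
  have ht := Real.sqrt_pos.2 h
  refine ⟨√(N.metric x a a).re, ((√(N.metric x a a).re)⁻¹ : ℂ) • a, ht, ?_, ?_⟩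
  · rw [metric_eq_one_iff, metric_smul_self_re, ← Complex.ofReal_inv, Complex.normSq_ofReal,
      ← mul_inv, Real.mul_self_sqrt h.le, inv_mul_cancel₀ h.ne']
  · rw [smul_smul, mul_inv_cancel₀ (by exact_mod_cast ht.ne'), one_smul]

/-- A linear map that preserves the length of vectors preserves the metric. -/
theorem metric_map_eq {N : HermitianLineBundle.{w} E M} {N' : HermitianLineBundle.{w'} E M} {x : M}
    (f : N.Fiber x →ₗ[ℂ] N'.Fiber x)
    (h : ∀ a, (N'.metric x (f a) (f a)).re = (N.metric x a a).re) (a b : N.Fiber x) :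
    N'.metric x (f a) (f b) = N.metric x a b := by
  by_cases ha : a = 0
  · simp [ha]
  · obtain ⟨z, rfl⟩ := exists_smul_eq ha b
    rw [map_smul, map_smul, map_smul, N'.metric_self, h a, ← N.metric_self]

end HermitianLineBundle

/-! ### Quadratic maps between lines and the metric they determine -/

theorem quad_smul {V W : Type*} [AddCommGroup V] [Module ℂ V] [AddCommGroup W] [Module ℂ W]
    (q : QuadraticMap ℂ V W) (z : ℂ) (a : V) : q (z • a) = z ^ 2 • q a := by
  rw [q.map_smul, sq]

/-- Write `a = t b` with `b` a unit vector and `t > 0`. Then `q(a) = t² q(b)` with `q(b)` of length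
one, so both sides are `t⁴`. Hence `q` determines the metric. -/
theorem HermitianSqrt.metric_quad {L : HermitianLineBundle.{w'} E M} (N : HermitianSqrt.{w} L) (x : M)
    (a : N.bundle.Fiber x) :
    (L.metric x (N.quad x a) (N.quad x a)).re = (N.bundle.metric x a a).re ^ 2 := by
  by_cases ha : a = 0
  · simp [ha]
  · obtain ⟨t, b, ht, hb, rfl⟩ := N.bundle.exists_unit_smul ha
    rw [quad_smul, HermitianLineBundle.metric_smul_self_re, N.unit x b hb,
      HermitianLineBundle.metric_smul_self_re, hb]
    simp [Complex.normSq_ofReal, sq]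

/-- The sesquilinear form `(a, b) ↦ r conj(ℓ a) ℓ b`. -/
def lineMetric {V : Type*} [AddCommGroup V] [Module ℂ V] (l : V →ₗ[ℂ] ℂ) (r : ℝ) :
    V →ₗ⋆[ℂ] V →ₗ[ℂ] ℂ :=
  LinearMap.mk₂'ₛₗ (starRingEnd ℂ) (RingHom.id ℂ) (fun a b => r * ((starRingEnd ℂ) (l a) * l b))
    (fun a b c => by rw [map_add, map_add]; ring)
    (fun t a b => by simp; ring)
    (fun a b c => by rw [map_add]; ring)
    (fun t a b => by simp; ring)

theorem lineMetric_apply {V : Type*} [AddCommGroup V] [Module ℂ V] (l : V →ₗ[ℂ] ℂ) (r : ℝ)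
    (a b : V) : lineMetric l r a b = r * ((starRingEnd ℂ) (l a) * l b) := rfl

theorem lineMetric_self {V : Type*} [AddCommGroup V] [Module ℂ V] (l : V →ₗ[ℂ] ℂ) (r : ℝ)
    (a : V) : lineMetric l r a a = ((r * Complex.normSq (l a) : ℝ) : ℂ) := by
  rw [lineMetric_apply, ← Complex.normSq_eq_conj_mul_self]; push_cast; rfl

theorem lineMetric_conj_symm {V : Type*} [AddCommGroup V] [Module ℂ V] (l : V →ₗ[ℂ] ℂ) (r : ℝ)
    (a b : V) : (starRingEnd ℂ) (lineMetric l r a b) = lineMetric l r b a := by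
  simp [lineMetric_apply, mul_comm]

/-- A linear coordinate on a fibre. -/
def SmoothLineBundle.fiberCoord (N : SmoothLineBundle.{w} E M) (x : M) : N.Fiber x ≃ₗ[ℂ] ℂ :=
  (trivializationAt ℂ N.Fiber x).linearEquivAt ℂ x (mem_baseSet_trivializationAt ℂ N.Fiber x)

/-- On a line, vanishing at one nonzero vector propagates to all its multiples, so `q` would be
zero, contradicting surjectivity onto a nontrivial space. -/
theorem quad_ne_zero {V W : Type*} [AddCommGroup V] [Module ℂ V] [AddCommGroup W] [Module ℂ W]
    [Nontrivial W] (q : QuadraticMap ℂ V W) (hq : Function.Surjective q)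
    (hV : ∀ a : V, a ≠ 0 → ∀ b, ∃ z : ℂ, b = z • a) {a : V} (ha : a ≠ 0) : q a ≠ 0 := fun h => by
  obtain ⟨c, hc⟩ := exists_ne (0 : W)
  obtain ⟨b, rfl⟩ := hq c
  obtain ⟨z, rfl⟩ := hV a ha b
  exact hc (by rw [quad_smul, h, smul_zero])

instance (N : SmoothLineBundle.{w} E M) (x : M) : Nontrivial (N.Fiber x) :=
  (N.fiberCoord x).toEquiv.nontrivial

namespace SmoothSqrt

variable {L : HermitianLineBundle.{w'} E M} (N : SmoothSqrt.{w} L.toSmoothLineBundle)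

theorem quad_ne_zero {L : SmoothLineBundle.{w'} E M} (N : SmoothSqrt.{w} L) {x : M}
    {a : N.bundle.Fiber x} (ha : a ≠ 0) : N.quad x a ≠ 0 :=
  SquareRoot.quad_ne_zero (N.quad x) (N.surjective x) (fun _ h b => exists_smul_eq h b) ha

/-- The metric on a square root of a Hermitian line bundle for which the length of a vector is
the square root of the length of its image. -/
def metric (x : M) : N.bundle.Fiber x →ₗ⋆[ℂ] N.bundle.Fiber x →ₗ[ℂ] ℂ :=
  lineMetric (N.bundle.fiberCoord x).toLinearMap
    √(L.metric x (N.quad x ((N.bundle.fiberCoord x).symm 1))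
      (N.quad x ((N.bundle.fiberCoord x).symm 1))).re

/-- Replacing the reference vector by `z` times it multiplies the squared length of its image by
`|z|⁴`, whose root `|z|²` is how a Hermitian form scales. The metric is thus independent of the
fibre coordinate used to define it. -/
theorem metric_self (x : M) (a : N.bundle.Fiber x) :
    N.metric x a a = ((√(L.metric x (N.quad x a) (N.quad x a)).re : ℝ) : ℂ) := by
  obtain ⟨z, rfl⟩ := (N.bundle.fiberCoord x).symm.surjective a
  have h : (N.bundle.fiberCoord x).symm z = z • (N.bundle.fiberCoord x).symm 1 := by
    rw [← map_smul, smul_eq_mul, mul_one]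
  rw [metric, lineMetric_self]
  congr 1
  conv_rhs => rw [h, quad_smul, HermitianLineBundle.metric_smul_self_re, map_pow,
    Real.sqrt_mul (sq_nonneg _), Real.sqrt_sq (Complex.normSq_nonneg _)]
  rw [mul_comm]
  simp

/-- The Hermitian square root underlying a smooth square root. -/
def toHermitian : HermitianSqrt.{w} L where
  bundle :=
    { toSmoothLineBundle := N.bundle
      metric := N.metric
      conj_symm := fun x a b => lineMetric_conj_symm _ _ a b
      pos := fun x a ha => by
        rw [N.metric_self, Complex.ofReal_re]
        exact Real.sqrt_pos.2 (L.pos x _ (N.quad_ne_zero ha))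
      smooth_metric := by
        refine contMDiffOn_metric N.metric fun x => ?_
        obtain ⟨s, hs, h0⟩ := N.bundle.exists_frame x
        refine ⟨s, hs, h0, ?_⟩
        have h1 : L.SmoothAt (fun x => N.quad x (s x)) x :=
          SectionAt.map (f := fun x => N.quad x) N.smooth hs
        have h2 := L.contMDiffAt_metric h1 h1
        -- The real square root is smooth away from zero, and the quadratic map sends a nonvanishing
        -- frame to nonzero vectors.
        have h3 : ContDiffAt ℝ ∞ (fun z : ℂ => ((√z.re : ℝ) : ℂ))
            (L.metric x (N.quad x (s x)) (N.quad x (s x))) := by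
          refine Complex.ofRealCLM.contDiff.contDiffAt.comp _
            (ContDiffAt.sqrt Complex.reCLM.contDiff.contDiffAt ?_)
          exact (L.pos x _ (N.quad_ne_zero h0)).ne'
        refine (h3.contMDiffAt.comp x h2).congr_of_eventuallyEq (Eventually.of_forall fun y => ?_)
        exact N.metric_self y (s y) }
  quad := N.quad
  surjective := N.surjective
  smooth := N.smooth
  unit x a h := by
    have h' : N.metric x a a = 1 := h
    rw [N.metric_self] at h'
    rw [HermitianLineBundle.metric_eq_one_iff]
    exact Real.sqrt_eq_one.1 (by exact_mod_cast h')

end SmoothSqrt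

variable (L : HermitianLineBundle.{w'} E M)

/-- Fullness: `metric_quad` turns compatibility with the quadratic maps into preservation of
lengths, which suffices for unitarity. The metric built on a smooth square root leaves the
underlying object unchanged, so the identity gives essential surjectivity. -/
theorem HermitianSqrt.forget_isEquivalence : (HermitianSqrt.forget.{w} L).IsEquivalence where
  faithful := ⟨fun {N N'} φ ψ h => HermitianSqrt.Hom.ext 
    (congrArg (fun f : SmoothSqrt.Hom _ _ => f.toEquiv) h :)⟩
  full := ⟨fun {N N'} φ => ⟨
    { toEquiv := φ.toEquiv
      smooth := φ.smooth
      smooth_symm := φ.smooth_symm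
      comm := φ.comm
      unitary := fun x => HermitianLineBundle.metric_map_eq (φ.toEquiv x).toLinearMap fun a => by
        have h1 := N.metric_quad x a
        have h2 := N'.metric_quad x (φ.toEquiv x a)
        have h3 : N'.quad x (φ.toEquiv x a) = N.quad x a := φ.comm x a
        rw [h3, h1] at h2
        exact ((sq_eq_sq₀ (N.bundle.metric_self_nonneg x _)
          (N'.bundle.metric_self_nonneg x _)).1 h2).symm }, rfl⟩⟩
  essSurj := ⟨fun N => ⟨N.toHermitian, ⟨Iso.refl N⟩⟩⟩

end Metric

/-! ## Spin structures and Hermitian square roots -/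

section Spin

open Filter Topology

variable {E : Type v} [NormedAddCommGroup E] [NormedSpace ℝ E]
  {M : Type u} [TopologicalSpace M] [ChartedSpace E M]

theorem SmoothLineBundle.exists_localFrame (N : SmoothLineBundle.{w} E M) (x : M) :
    ∃ (U : TopologicalSpace.Opens M) (s : ∀ x, N.Fiber x), x ∈ U ∧
      ∀ y ∈ U, N.SmoothAt s y ∧ s y ≠ 0 := by
  let e := trivializationAt ℂ N.Fiber x
  exact ⟨⟨e.baseSet, e.open_baseSet⟩, fun x => e.symm x 1, mem_baseSet_trivializationAt ℂ N.Fiber x,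
    fun y hy => ⟨sectionAt_frame e hy 1, symm_one_ne_zero e hy⟩⟩

/-- The section of a line bundle underlying a local section is smooth. -/
def SmoothLineBundle.IsSmooth (N : SmoothLineBundle.{w} E M) (σ : LocalSection N.Fiber) : Prop :=
  ∀ x ∈ σ.domain, N.SmoothAt σ.extend x

/-! ### Torsors of a circle group mapped equivariantly into a line bundle -/

section Circle

variable {A : Type*} [Ring A] [Algebra ℝ A] {G : Submonoid A} (χ : G → ℂ)
  (hχ : ∀ (g : M → G) (s : Set M), SmoothInto E (fun x => (g x : A)) s ↔
    ContMDiffOn 𝓘(ℝ, E) 𝓘(ℝ, ℂ) ∞ (fun x => χ (g x)) s)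

include hχ

/-- Local sections of a family of `G`-torsors that map to smooth nonvanishing sections of a
line bundle are smooth relative to each other. -/
theorem smoothRel_of_isSmooth {P : M → Type w} [∀ x, MulAction (↥G)ᵐᵒᵖ (P x)]
    (hP : ∀ x (p q : P x), ∃ g : G, p <• g = q) (N : SmoothLineBundle.{w'} E M)
    (m : ∀ x, P x → N.Fiber x) (hm : ∀ x p g, m x (p <• g) = χ g • m x p)
    (h0 : ∀ x p, m x p ≠ 0) {σ τ : LocalSection P} (hσ : N.IsSmooth (σ.map m))
    (hτ : N.IsSmooth (τ.map m)) : LocalSection.SmoothRel E G σ τ := by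
  have h : ∀ x, ∃ g : G, ∀ (hσ : x ∈ σ.domain) (hτ : x ∈ τ.domain),
      τ.toFun x hτ <• g = σ.toFun x hσ := fun x => by
    by_cases hx : x ∈ σ.domain ∧ x ∈ τ.domain
    · exact (hP x (τ.toFun x hx.2) (σ.toFun x hx.1)).imp fun g hg _ _ => hg
    -- Off the common domain the value of `g` is immaterial, since smoothness is only required on
    -- the overlap.
    · exact ⟨1, fun h1 h2 => absurd ⟨h1, h2⟩ hx⟩
  choose g hg using h
  refine ⟨g, (hχ g _).2 fun x hx => ContMDiffAt.contMDiffWithinAt ?_,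
    fun x h1 h2 => (hg x h1 h2).symm⟩
  refine SectionAt.coeff (hσ x hx.1) (hτ x hx.2) ?_ ?_
  · rw [(τ.map m).extend_of_mem hx.2]; exact h0 _ _
  · filter_upwards [σ.domain.isOpen.mem_nhds hx.1, τ.domain.isOpen.mem_nhds hx.2] with y h1 h2
    rw [(τ.map m).extend_of_mem h2, (σ.map m).extend_of_mem h1]
    exact (congrArg (m y) (hg y h1 h2).symm).trans (hm _ _ _)

/-- From `σ = τ · g` follows `m σ = χ(g) m τ`, a smooth multiple of a smooth section. -/
theorem isSmooth_of_smoothRel {P : M → Type w} [∀ x, MulAction (↥G)ᵐᵒᵖ (P x)]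
    (N : SmoothLineBundle.{w'} E M) (m : ∀ x, P x → N.Fiber x)
    (hm : ∀ x p g, m x (p <• g) = χ g • m x p) {σ : LocalSection P}
    (h : ∀ x ∈ σ.domain, ∃ τ : LocalSection P, x ∈ τ.domain ∧ N.IsSmooth (τ.map m) ∧
      LocalSection.SmoothRel E G σ τ) : N.IsSmooth (σ.map m) := by
  intro x hx
  obtain ⟨τ, hxτ, hτ, g, hg, hgx⟩ := h x hx
  have h1 := ((hχ g _).1 hg).contMDiffAt
    ((σ.domain.isOpen.inter τ.domain.isOpen).mem_nhds ⟨hx, hxτ⟩)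
  refine SectionAt.congr (SectionAt.smul (hτ x hxτ) h1) ?_
  filter_upwards [σ.domain.isOpen.mem_nhds hx, τ.domain.isOpen.mem_nhds hxτ] with y h1 h2
  rw [(τ.map m).extend_of_mem h2, (σ.map m).extend_of_mem h1]
  exact (congrArg (m y) (hgx y h1 h2)).trans (hm _ _ _)

/-- This replaces the atlas of a principal bundle by smoothness of sections of a line bundle. It is
applied to `Q` inside `L`, to the unit vectors of a Hermitian bundle, and to a spin structure inside
its associated line. -/
theorem PrincipalBundle.isSmooth_iff (P : PrincipalBundle.{w} E M G) (N : SmoothLineBundle.{w'} E M)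
    (m : ∀ x, P.Fiber x → N.Fiber x) (hm : ∀ x p g, m x (p <• g) = χ g • m x p)
    (h0 : ∀ x p, m x p ≠ 0) (hP : ∀ τ ∈ P.atlas, N.IsSmooth (τ.map m))
    (σ : LocalSection P.Fiber) : P.IsSmooth σ ↔ N.IsSmooth (σ.map m) := by
  constructor
  · intro h
    refine isSmooth_of_smoothRel χ hχ N m hm fun x _ => ?_
    obtain ⟨τ, hτ, hx⟩ := P.exists_mem_atlas x
    exact ⟨τ, hx, hP τ hτ, h τ hτ⟩
  · intro h τ hτ
    exact smoothRel_of_isSmooth χ hχ (fun x p q => (P.existsUnique_smul x p q).exists) N m hm h0 h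
      (hP τ hτ)

end Circle

/-! ### The unit vectors of the associated line bundle -/

namespace PrincipalBundle

variable (Q : PrincipalBundle.{w'} E M SO2)

theorem associatedMk_eq_smul {x : M} (q : Q.Fiber x) (z : ℂ) :
    Q.associatedMk q z = z • Q.associatedMk q 1 := by
  unfold associatedMk
  rw [mul_one, mul_comm]
  rfl

theorem associatedMk_smul_one {x : M} (q : Q.Fiber x) (g : SO2) :
    Q.associatedMk (q <• g) 1 = SO2.toComplex g • Q.associatedMk q 1 := by
  rw [Q.associatedMk_smul, mul_one, Q.associatedMk_eq_smul]

theorem metric_associatedMk {x : M} (q : Q.Fiber x) :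
    Q.associatedLineBundle.metric x (Q.associatedMk q 1) (Q.associatedMk q 1) = 1 := by
  change (starRingEnd ℂ) (_ * (1 : ℂ)) * (_ * (1 : ℂ)) = 1
  rw [mul_one]
  exact SO2.conj_mul_toComplex _

theorem associatedMk_one_ne_zero {x : M} (q : Q.Fiber x) : Q.associatedMk q 1 ≠ 0 :=
  HermitianLineBundle.ne_zero_of_metric_eq_one _ (Q.metric_associatedMk q)

theorem associatedMk_one_injective {x : M} {q q' : Q.Fiber x}
    (h : Q.associatedMk q 1 = Q.associatedMk q' 1) : q = q' := by
  obtain ⟨g, rfl⟩ := (Q.existsUnique_smul x q q').exists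
  rw [Q.associatedMk_smul, mul_one] at h
  have h1 := (Q.associatedMk_bijective q).1 h
  rw [← SO2.toComplex_one] at h1
  rw [← SO2.toComplex_injective h1]
  simp

/-- Any vector is `[q, z]`; having length one means `|z| = 1`, so `z` is a rotation `g` and `[q, z]
= [q · g, 1]`. With injectivity this identifies `Q` with the unit vectors of `L`. -/
theorem exists_associatedMk_eq {x : M} {a : Q.associatedLineBundle.Fiber x}
    (ha : Q.associatedLineBundle.metric x a a = 1) : ∃ q : Q.Fiber x, Q.associatedMk q 1 = a := by
  obtain ⟨τ, -, hτ⟩ := Q.exists_mem_atlas x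
  obtain ⟨z, rfl⟩ := (Q.associatedMk_bijective (τ.toFun x hτ)).2 a
  rw [Q.associatedMk_eq_smul, HermitianLineBundle.metric_smul_self, Q.metric_associatedMk,
    mul_one] at ha
  obtain ⟨g, rfl⟩ := SO2.exists_toComplex_eq ha
  exact ⟨τ.toFun x hτ <• g, by rw [Q.associatedMk_smul, mul_one]⟩

/-- The section `[τ, 1]` has constant coordinate `1` in the trivialization given by `τ`. -/
theorem isSmooth_associatedMk {τ : LocalSection Q.Fiber} (hτ : τ ∈ Q.atlas) :
    Q.associatedLineBundle.IsSmooth (τ.map fun _ q => Q.associatedMk q 1) := by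
  intro x hx
  let e : Trivialization ℂ (π ℂ Q.associatedLineBundle.Fiber) :=
    Q.associatedCore.localTriv ⟨τ, hτ⟩
  have he : MemTrivializationAtlas e := ⟨⟨⟨τ, hτ⟩, rfl⟩⟩
  refine (sectionAt_iff e hx).2 ?_
  refine (contMDiffAt_const (c := (1 : ℂ))).congr_of_eventuallyEq ?_
  filter_upwards [τ.domain.isOpen.mem_nhds hx] with y hy
  rw [(τ.map fun _ q => Q.associatedMk q 1).extend_of_mem hy]
  -- The fibre over `y` is coordinatized by the chosen section `indexAt y`; passing to `τ`
  -- multiplies by the difference from `τ` to that section, which cancels the difference from that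
  -- section to `τ`.
  change Q.transition (Q.associatedCore.indexAt y) ⟨τ, hτ⟩ y * (SO2.toComplex _ * 1) = 1
  rw [Q.transition_of_mem _ _ (Q.associatedCore.mem_baseSet_at y) hy, mul_one,
    ← SO2.toComplex_mul, Q.diff_mul_diff]
  exact (congrArg _ (Q.diff_self _)).trans SO2.toComplex_one

theorem isSmooth_iff_associatedMk (σ : LocalSection Q.Fiber) :
    Q.IsSmooth σ ↔ Q.associatedLineBundle.IsSmooth (σ.map fun _ q => Q.associatedMk q 1) :=
  Q.isSmooth_iff SO2.toComplex SO2.smoothInto_iff _ _ (fun _ => Q.associatedMk_smul_one)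
    (fun _ => Q.associatedMk_one_ne_zero) (fun _ => Q.isSmooth_associatedMk) σ

end PrincipalBundle

/-! ### The bundle of unit vectors of a Hermitian line bundle -/

namespace HermitianLineBundle

variable (N : HermitianLineBundle.{w} E M)

/-- The unit vectors in a fibre. -/
def UnitFiber (x : M) : Type w := {a : N.Fiber x // N.metric x a a = 1}

variable {N} in
/-- The inclusion of the unit vectors. -/
def UnitFiber.val {x : M} (a : N.UnitFiber x) : N.Fiber x := Subtype.val a

variable {N} in
theorem UnitFiber.ext {x : M} {a b : N.UnitFiber x} (h : a.val = b.val) : a = b := Subtype.ext h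

variable {N} in
theorem UnitFiber.metric_eq {x : M} (a : N.UnitFiber x) : N.metric x a.val a.val = 1 :=
  Subtype.property a

variable {N} in
theorem UnitFiber.ne_zero {x : M} (a : N.UnitFiber x) : a.val ≠ 0 :=
  N.ne_zero_of_metric_eq_one a.metric_eq

instance (x : M) : MulAction (↥Spin2)ᵐᵒᵖ (N.UnitFiber x) where
  smul g a := ⟨Spin2.toComplex g.unop • a.val, by
    rw [metric_smul_self, a.metric_eq, mul_one, Spin2.conj_mul_toComplex]⟩
  one_smul a := UnitFiber.ext <| by
    change Spin2.toComplex 1 • a.val = a.val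
    rw [Spin2.toComplex_one, one_smul]
  mul_smul g h a := UnitFiber.ext <| by
    change Spin2.toComplex (h.unop * g.unop) • a.val =
      Spin2.toComplex g.unop • (Spin2.toComplex h.unop • a.val)
    rw [Spin2.toComplex_mul, smul_smul, mul_comm]

variable {N} in
theorem UnitFiber.val_smul {x : M} (a : N.UnitFiber x) (g : Spin2) :
    (a <• g).val = Spin2.toComplex g • a.val := rfl

theorem existsUnique_smul (x : M) (a b : N.UnitFiber x) : ∃! g : Spin2, a <• g = b := by
  obtain ⟨z, hz⟩ := exists_smul_eq a.ne_zero b.val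
  have h := b.metric_eq
  rw [hz, metric_smul_self, a.metric_eq, mul_one] at h
  obtain ⟨g, rfl⟩ := Spin2.exists_toComplex_eq h
  refine ⟨g, UnitFiber.ext hz.symm, fun g' hg' => Spin2.toComplex_injective ?_⟩
  have h1 : Spin2.toComplex g' • a.val = Spin2.toComplex g • a.val :=
    (congrArg UnitFiber.val hg').trans hz
  exact smul_left_injective ℂ a.ne_zero h1

/-- A nonvanishing smooth frame divided by its length, which is smooth and positive, is a smooth
unit section. -/
theorem exists_isSmooth (x : M) : ∃ σ : LocalSection N.UnitFiber,
    N.IsSmooth (σ.map fun _ => UnitFiber.val) ∧ x ∈ σ.domain := by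
  obtain ⟨U, s, hx, hs⟩ := N.exists_localFrame x
  let c : M → ℂ := fun y => (((√(N.metric y (s y) (s y)).re)⁻¹ : ℝ) : ℂ)
  refine ⟨⟨U, fun y hy => ⟨c y • s y, ?_⟩⟩, fun y hy => ?_, hx⟩
  · have h := N.pos y (s y) (hs y hy).2
    rw [metric_eq_one_iff, metric_smul_self_re, Complex.normSq_ofReal, ← mul_inv,
      Real.mul_self_sqrt h.le, inv_mul_cancel₀ h.ne']
  · have hs' := hs y hy
    have h := N.pos y (s y) hs'.2
    have hc : ContMDiffAt 𝓘(ℝ, E) 𝓘(ℝ, ℂ) ∞ c y := by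
      have h3 : ContDiffAt ℝ ∞ (fun z : ℂ => (((√z.re)⁻¹ : ℝ) : ℂ)) (N.metric y (s y) (s y)) :=
        Complex.ofRealCLM.contDiff.contDiffAt.comp _
          ((ContDiffAt.sqrt Complex.reCLM.contDiff.contDiffAt h.ne').inv (Real.sqrt_pos.2 h).ne')
      exact h3.contMDiffAt.comp y (N.contMDiffAt_metric hs'.1 hs'.1)
    refine SectionAt.congr (SectionAt.smul hs'.1 hc) ?_
    filter_upwards [U.isOpen.mem_nhds hy] with t ht
    exact LocalSection.extend_of_mem _ ht

/-- The principal `Spin₂`-bundle of unit vectors of a Hermitian line bundle. -/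
def unitBundle : PrincipalBundle.{w} E M Spin2 where
  Fiber := N.UnitFiber
  existsUnique_smul := N.existsUnique_smul
  -- Taking all smooth unit sections avoids any choice of atlas and makes its sections smooth in the
  -- line bundle by definition.
  atlas := {σ | N.IsSmooth (σ.map fun _ => UnitFiber.val)}
  exists_mem_atlas := N.exists_isSmooth
  smooth_atlas _ hσ _ hτ := smoothRel_of_isSmooth Spin2.toComplex Spin2.smoothInto_iff
    (fun x p q => (N.existsUnique_smul x p q).exists) N.toSmoothLineBundle (fun _ => UnitFiber.val)
    (fun _ => UnitFiber.val_smul) (fun _ => UnitFiber.ne_zero) hσ hτ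

theorem unitBundle_isSmooth_iff (σ : LocalSection N.UnitFiber) :
    N.unitBundle.IsSmooth σ ↔ N.IsSmooth (σ.map fun _ => UnitFiber.val) :=
  N.unitBundle.isSmooth_iff Spin2.toComplex Spin2.smoothInto_iff N.toSmoothLineBundle
    (fun _ => UnitFiber.val) (fun _ => UnitFiber.val_smul) (fun _ => UnitFiber.ne_zero)
    (fun _ h => h) σ

end HermitianLineBundle

theorem SmoothLineBundle.IsSmooth.map {N : SmoothLineBundle.{w} E M} {N' : SmoothLineBundle.{w'} E M}
    {f : ∀ x, N.Fiber x → N'.Fiber x} (hf : N.SmoothMap N' f) {σ : LocalSection N.Fiber}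
    (hσ : N.IsSmooth σ) : N'.IsSmooth (σ.map f) := fun x hx => by
  refine SectionAt.congr (SectionAt.map hf (hσ x hx)) ?_
  filter_upwards [σ.domain.isOpen.mem_nhds hx] with y hy
  rw [σ.extend_of_mem hy]
  exact (σ.map f).extend_of_mem hy

end Spin

section SpinFunctor

open Filter Topology

variable {E : Type v} [NormedAddCommGroup E] [NormedSpace ℝ E]
  {M : Type u} [TopologicalSpace M] [ChartedSpace E M]

/-! ### From Hermitian square roots to spin structures -/

/-- The inverse of an equivalence of spin structures. -/
def SpinStructure.Hom.symm {Q : PrincipalBundle.{w'} E M SO2} {P P' : SpinStructure.{w} Q}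
    (φ : Hom P P') : Hom P' P where
  toEquiv x := (φ.toEquiv x).symm
  map_smul x p g := by
    rw [Equiv.symm_apply_eq, φ.map_smul, Equiv.apply_symm_apply]
  smooth := φ.smooth_symm
  smooth_symm := φ.smooth
  comm x p := by rw [← φ.comm, Equiv.apply_symm_apply]

/-- An equivalence of spin structures as an isomorphism in the category of spin structures. -/
def SpinStructure.Hom.iso {Q : PrincipalBundle.{w'} E M SO2} {P P' : SpinStructure.{w} Q}
    (φ : Hom P P') : P ≅ P' where
  hom := φ
  inv := φ.symm
  hom_inv_id := SpinStructure.Hom.ext (funext fun x => Equiv.self_trans_symm (φ.toEquiv x))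
  inv_hom_id := SpinStructure.Hom.ext (funext fun x => Equiv.symm_trans_self (φ.toEquiv x))

namespace HermitianSqrt

variable {Q : PrincipalBundle.{w'} E M SO2}

section

variable (N : HermitianSqrt.{w} Q.associatedLineBundle)

/-- The point of `Q` that corresponds to the image of a unit vector. -/
def unitMap (x : M) (a : N.bundle.UnitFiber x) : Q.Fiber x :=
  (Q.exists_associatedMk_eq (N.unit x a.val a.metric_eq)).choose

theorem associatedMk_unitMap (x : M) (a : N.bundle.UnitFiber x) :
    Q.associatedMk (N.unitMap x a) 1 = N.quad x a.val :=
  (Q.exists_associatedMk_eq (N.unit x a.val a.metric_eq)).choose_spec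

/-- After applying `[·, 1]` this is `q(za) = z² q(a)`, where `z²` is the rotation covered by `z`. -/
theorem unitMap_smul (x : M) (a : N.bundle.UnitFiber x) (s : Spin2) :
    N.unitMap x (a <• s) = N.unitMap x a <• spinCover s := by
  apply Q.associatedMk_one_injective
  rw [Q.associatedMk_smul_one, N.associatedMk_unitMap, N.associatedMk_unitMap,
    Spin2.toComplex_spinCover, ← sq, ← quad_smul, HermitianLineBundle.UnitFiber.val_smul]

/-- Smoothness in `Q` is tested through `[·, 1]`, where `unitMap` becomes the smooth map `q`. -/
theorem isSmooth_unitMap {σ : LocalSection N.bundle.UnitFiber}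
    (hσ : N.bundle.IsSmooth (σ.map fun _ => HermitianLineBundle.UnitFiber.val)) :
    Q.IsSmooth (σ.map N.unitMap) := by
  rw [Q.isSmooth_iff_associatedMk]
  have h := SmoothLineBundle.IsSmooth.map N.smooth hσ
  have h1 : (σ.map N.unitMap).map (fun _ q => Q.associatedMk q 1) =
      (σ.map fun _ => HermitianLineBundle.UnitFiber.val).map fun x => N.quad x :=
    congrArg (LocalSection.mk σ.domain) (funext fun x => funext fun hx =>
      N.associatedMk_unitMap x (σ.toFun x hx))
  rw [h1]
  exact h

/-- The spin structure given by the unit vectors of a Hermitian square root. -/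
def toSpin : SpinStructure.{w} Q where
  bundle := N.bundle.unitBundle
  toFun := N.unitMap
  map_smul := N.unitMap_smul
  smooth _ hσ := N.isSmooth_unitMap ((HermitianLineBundle.unitBundle_isSmooth_iff _ _).1 hσ)

end

variable {N N' : HermitianSqrt.{w} Q.associatedLineBundle}

/-- The map between unit vectors given by a unitary isomorphism. -/
def Hom.unitEquiv (φ : Hom N N') (x : M) : N.bundle.UnitFiber x ≃ N'.bundle.UnitFiber x :=
  (φ.toEquiv x).toEquiv.subtypeEquiv fun a => by
    exact (φ.unitary x a a).symm ▸ Iff.rfl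

/-- The map of spin structures given by a morphism of Hermitian square roots. -/
def Hom.toSpin (φ : Hom N N') : SpinStructure.Hom N.toSpin N'.toSpin where
  toEquiv := φ.unitEquiv
  map_smul x a g := HermitianLineBundle.UnitFiber.ext ((φ.toEquiv x).map_smul _ a.val)
  smooth σ hσ := by
    have hσ' := (HermitianLineBundle.unitBundle_isSmooth_iff _ _).1 hσ
    exact (HermitianLineBundle.unitBundle_isSmooth_iff _ _).2 (hσ'.map φ.smooth)
  smooth_symm σ hσ := by
    have hσ' := (HermitianLineBundle.unitBundle_isSmooth_iff _ _).1 hσ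
    exact (HermitianLineBundle.unitBundle_isSmooth_iff _ _).2 (hσ'.map φ.smooth_symm)
  comm x a := by
    apply Q.associatedMk_one_injective
    exact (N'.associatedMk_unitMap x _).trans
      ((φ.comm x a.val).trans (N.associatedMk_unitMap x a).symm)

variable (Q) in
/-- The functor from Hermitian square roots to spin structures. -/
def spinFunctor : HermitianSqrt.{w} Q.associatedLineBundle ⥤ SpinStructure.{w} Q where
  obj N := N.toSpin
  map φ := Hom.toSpin φ

/-! ### Linear extension of maps between unit circles -/

theorem exists_unit (N : HermitianLineBundle.{w} E M) (x : M) : Nonempty (N.UnitFiber x) := by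
  obtain ⟨σ, -, hx⟩ := N.exists_isSmooth x
  exact ⟨σ.toFun x hx⟩

/-- Some linear isomorphism between two lines takes a given nonzero vector to another. -/
theorem exists_linearEquiv {N N' : SmoothLineBundle.{w} E M} {x : M} {a : N.Fiber x}
    {b : N'.Fiber x} (ha : a ≠ 0) (hb : b ≠ 0) : ∃ f : N.Fiber x ≃ₗ[ℂ] N'.Fiber x, f a = b := by
  have ha' : N.fiberCoord x a ≠ 0 := by simpa using ha
  have hb' : N'.fiberCoord x b ≠ 0 := by simpa using hb
  refine ⟨(N.fiberCoord x).trans ((LinearEquiv.smulOfNeZero ℂ ℂ _ (div_ne_zero hb' ha')).trans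
    (N'.fiberCoord x).symm), ?_⟩
  simp [div_mul_cancel₀ _ ha']

/-- Choose the linear isomorphism that agrees with `f` at one unit vector. Every other unit vector
is a circle multiple of it, so equivariance gives agreement everywhere. -/
theorem exists_linearEquiv_unit {N N' : HermitianLineBundle.{w} E M} {x : M}
    (f : N.UnitFiber x → N'.UnitFiber x) (hf : ∀ a (g : Spin2), f (a <• g) = f a <• g) :
    ∃ F : N.Fiber x ≃ₗ[ℂ] N'.Fiber x, ∀ a : N.UnitFiber x, F a.val = (f a).val := by
  obtain ⟨a⟩ := exists_unit N x
  obtain ⟨F, hF⟩ := exists_linearEquiv (N := N.toSmoothLineBundle) (N' := N'.toSmoothLineBundle)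
    a.ne_zero (f a).ne_zero
  refine ⟨F, fun b => ?_⟩
  obtain ⟨g, rfl⟩ := (N.existsUnique_smul x a b).exists
  rw [hf, HermitianLineBundle.UnitFiber.val_smul, HermitianLineBundle.UnitFiber.val_smul, ← hF]
  exact map_smul F _ _

/-- A linear map is homogeneous of degree one, so it is enough to test it on a smooth unit section,
where it coincides with `f`. -/
theorem smoothMap_of_unit {N N' : HermitianLineBundle.{w} E M}
    (F : ∀ x, N.Fiber x →ₗ[ℂ] N'.Fiber x) (f : ∀ x, N.UnitFiber x → N'.UnitFiber x)
    (hF : ∀ x (a : N.UnitFiber x), F x a.val = (f x a).val)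
    (hf : N.unitBundle.SmoothMap N'.unitBundle f) :
    N.SmoothMap N'.toSmoothLineBundle fun x => F x := by
  refine contMDiff_of_homogeneous (fun x => F x) 1 (fun x z a => by simp) fun x => ?_
  obtain ⟨σ, hσ, hx⟩ := N.exists_isSmooth x
  have h := (HermitianLineBundle.unitBundle_isSmooth_iff _ _).1
    (hf σ ((HermitianLineBundle.unitBundle_isSmooth_iff _ _).2 hσ))
  refine ⟨_, hσ x hx, ?_, SectionAt.congr (h x hx) ?_⟩
  · rw [(σ.map fun _ => HermitianLineBundle.UnitFiber.val).extend_of_mem hx]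
    exact (σ.toFun x hx).ne_zero
  · filter_upwards [σ.domain.isOpen.mem_nhds hx] with y hy
    rw [(σ.map fun _ => HermitianLineBundle.UnitFiber.val).extend_of_mem hy]
    exact (hF y _).trans
      (((σ.map f).map fun _ => HermitianLineBundle.UnitFiber.val).extend_of_mem hy).symm

/-- Every nonzero vector is a multiple of a unit vector, so a linear map is determined on the unit
circle. -/
instance : (spinFunctor.{w} Q).Faithful where
  map_injective {N N'} φ ψ h := by
    refine Hom.ext (funext fun x => LinearEquiv.ext fun a => ?_)
    have h1 : Hom.unitEquiv φ = Hom.unitEquiv ψ :=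
      congrArg (fun f : SpinStructure.Hom _ _ => f.toEquiv) h
    by_cases ha : a = 0
    · simp [ha]
    · obtain ⟨t, b, -, hb, rfl⟩ := N.bundle.exists_unit_smul ha
      have h2 := congrArg (fun f : N.bundle.UnitFiber x ≃ N'.bundle.UnitFiber x =>
        (f ⟨b, hb⟩).val) (congrFun h1 x)
      rw [map_smul, map_smul]
      exact congrArg _ h2

/-- A morphism of spin structures extends fibrewise to linear isomorphisms. Unitarity and
compatibility with the quadratic maps hold on unit vectors and pass to all vectors by homogeneity.
-/
instance : (spinFunctor.{w} Q).Full where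
  map_surjective {N N'} ψ := by
    let f : ∀ x, N.bundle.UnitFiber x ≃ N'.bundle.UnitFiber x := ψ.toEquiv
    have hf : ∀ x a, N'.unitMap x (f x a) = N.unitMap x a := ψ.comm
    have h : ∀ x, ∃ F : N.bundle.Fiber x ≃ₗ[ℂ] N'.bundle.Fiber x,
        ∀ a : N.bundle.UnitFiber x, F a.val = (f x a).val :=
      fun x => exists_linearEquiv_unit (f x) (ψ.map_smul x)
    choose F hF using h
    have hF' : ∀ x (a : N'.bundle.UnitFiber x), (F x).symm a.val = ((f x).symm a).val :=
      fun x a => by rw [LinearEquiv.symm_apply_eq, hF, (f x).apply_symm_apply]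
    refine ⟨{ toEquiv := F
              smooth := smoothMap_of_unit (fun x => (F x).toLinearMap) _ hF ψ.smooth
              smooth_symm := smoothMap_of_unit (fun x => (F x).symm.toLinearMap) _ hF' ψ.smooth_symm
              unitary := fun x => HermitianLineBundle.metric_map_eq (F x).toLinearMap fun a => ?_
              comm := fun x a => ?_ }, ?_⟩
    · by_cases ha : a = 0
      · simp [ha]
      · obtain ⟨t, b, -, hb, rfl⟩ := N.bundle.exists_unit_smul ha
        rw [map_smul, HermitianLineBundle.metric_smul_self_re,
          HermitianLineBundle.metric_smul_self_re, hb]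
        have h1 : (F x).toLinearMap b = _ := hF x ⟨b, hb⟩
        rw [h1, HermitianLineBundle.UnitFiber.metric_eq]
    · by_cases ha : a = 0
      · simp [ha]
      · obtain ⟨t, b, -, hb, rfl⟩ := N.bundle.exists_unit_smul ha
        rw [map_smul, quad_smul, quad_smul]
        obtain ⟨b', rfl⟩ : ∃ b' : N.bundle.UnitFiber x, b'.val = b := ⟨⟨b, hb⟩, rfl⟩
        rw [hF, ← N'.associatedMk_unitMap, hf, N.associatedMk_unitMap]
    · exact SpinStructure.Hom.ext (funext fun x => Equiv.ext fun a =>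
        HermitianLineBundle.UnitFiber.ext (hF x a))

end HermitianSqrt

end SpinFunctor

/-! ### From spin structures to Hermitian square roots -/

namespace SpinStructure

open Filter Topology

variable {E : Type v} [NormedAddCommGroup E] [NormedSpace ℝ E]
  {M : Type u} [TopologicalSpace M] [ChartedSpace E M]
  {Q : PrincipalBundle.{w'} E M SO2} (P : SpinStructure.{w} Q)

/-- A point of the fibre. -/
def basePoint (x : M) : P.bundle.Fiber x :=
  (P.bundle.exists_mem_atlas x).choose.toFun x (P.bundle.exists_mem_atlas x).choose_spec.2

/-- The fibre of the line bundle associated with a spin structure, trivialized by the base point. -/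
def LineFiber (_ : SpinStructure.{w} Q) (_ : M) : Type w := ULift.{w} ℂ

instance (x : M) : AddCommGroup (P.LineFiber x) := inferInstanceAs (AddCommGroup (ULift ℂ))

instance (x : M) : Module ℂ (P.LineFiber x) := inferInstanceAs (Module ℂ (ULift ℂ))

/-- The coordinate with respect to the base point. -/
def lineCoord (x : M) : P.LineFiber x ≃ₗ[ℂ] ℂ := ULift.moduleEquiv

/-- The class `[p, 1]` in the associated line bundle. -/
def lineMk (x : M) (p : P.bundle.Fiber x) : P.LineFiber x :=
  (P.lineCoord x).symm (Spin2.toComplex (P.bundle.diff (P.basePoint x) p))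

theorem lineCoord_lineMk (x : M) (p : P.bundle.Fiber x) :
    P.lineCoord x (P.lineMk x p) = Spin2.toComplex (P.bundle.diff (P.basePoint x) p) :=
  (P.lineCoord x).apply_symm_apply _

theorem lineMk_smul (x : M) (p : P.bundle.Fiber x) (g : Spin2) :
    P.lineMk x (p <• g) = Spin2.toComplex g • P.lineMk x p := by
  apply (P.lineCoord x).injective
  rw [_root_.map_smul, lineCoord_lineMk, lineCoord_lineMk, ← P.bundle.diff_mul_diff (P.basePoint x) p,
    P.bundle.diff_eq (p := p) rfl, Spin2.toComplex_mul, smul_eq_mul, mul_comm]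

theorem toComplex_ne_zero (g : Spin2) : Spin2.toComplex g ≠ 0 :=
  right_ne_zero_of_mul_eq_one (Spin2.conj_mul_toComplex g)

theorem lineMk_ne_zero (x : M) (p : P.bundle.Fiber x) : P.lineMk x p ≠ 0 := fun h => by
  have := P.lineCoord_lineMk x p
  rw [h, map_zero] at this
  exact toComplex_ne_zero _ this.symm

theorem existsUnique_smul_lineMk (x : M) (p : P.bundle.Fiber x) (a : P.LineFiber x) :
    ∃! z : ℂ, z • P.lineMk x p = a := by
  have h1 : P.lineCoord x (P.lineMk x p) ≠ 0 := by simpa using P.lineMk_ne_zero x p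
  refine ⟨P.lineCoord x a / P.lineCoord x (P.lineMk x p), (P.lineCoord x).injective ?_,
    fun z hz => ?_⟩
  · rw [_root_.map_smul, smul_eq_mul, div_mul_cancel₀ _ h1]
  · rw [← hz, _root_.map_smul, smul_eq_mul, mul_div_cancel_right₀ _ h1]

/-- The frames of the line bundle associated with a spin structure. -/
def frameAtlas : FrameAtlas ℝ ∞ E P.LineFiber where
  -- The base points are chosen without continuity and serve only to name the fibres; the smooth
  -- structure comes from the sections `[τ, 1]`.
  frames := (fun τ => τ.map P.lineMk) '' P.bundle.atlas
  existsUnique_smul := by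
    rintro _ ⟨τ, -, rfl⟩ x hx a
    exact P.existsUnique_smul_lineMk x (τ.toFun x hx) a
  exists_mem x := by
    obtain ⟨τ, hτ, hx⟩ := P.bundle.exists_mem_atlas x
    exact ⟨_, ⟨τ, hτ, rfl⟩, hx⟩
  contMDiffOn := by
    rintro _ ⟨σ, hσ, rfl⟩ _ ⟨τ, hτ, rfl⟩
    obtain ⟨g, hg, h⟩ := P.bundle.smooth_atlas σ hσ τ hτ
    refine ⟨_, (Spin2.smoothInto_iff g _).1 hg, fun x h1 h2 => ?_⟩
    exact (congrArg (P.lineMk x) (h x h1 h2)).trans (P.lineMk_smul x _ _)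

/-- The smooth line bundle associated with a spin structure. -/
def lineBundle : SmoothLineBundle.{w} E M := P.frameAtlas.toSmooth

/-- The class `[p, 1]` in the associated line bundle. -/
def unitVec (x : M) (p : P.bundle.Fiber x) : P.lineBundle.Fiber x := P.lineMk x p

theorem unitVec_smul (x : M) (p : P.bundle.Fiber x) (g : Spin2) :
    P.unitVec x (p <• g) = Spin2.toComplex g • P.unitVec x p := P.lineMk_smul x p g

theorem unitVec_ne_zero (x : M) (p : P.bundle.Fiber x) : P.unitVec x p ≠ 0 := P.lineMk_ne_zero x p

/-- The coordinate with respect to the base point. -/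
def coord (x : M) : P.lineBundle.Fiber x ≃ₗ[ℂ] ℂ := P.lineCoord x

theorem coord_unitVec (x : M) (p : P.bundle.Fiber x) :
    P.coord x (P.unitVec x p) = Spin2.toComplex (P.bundle.diff (P.basePoint x) p) :=
  P.lineCoord_lineMk x p

theorem isSmooth_unitVec {τ : LocalSection P.bundle.Fiber} (hτ : τ ∈ P.bundle.atlas) :
    P.lineBundle.IsSmooth (τ.map P.unitVec) := fun _ hx => P.frameAtlas.smoothAt_extend ⟨τ, hτ, rfl⟩ hx

theorem isSmooth_iff_unitVec (σ : LocalSection P.bundle.Fiber) :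
    P.bundle.IsSmooth σ ↔ P.lineBundle.IsSmooth (σ.map P.unitVec) :=
  P.bundle.isSmooth_iff Spin2.toComplex Spin2.smoothInto_iff _ _ P.unitVec_smul P.unitVec_ne_zero
    (fun _ => P.isSmooth_unitVec) σ

/-- The metric for which `[p, 1]` is a unit vector. -/
def metric (x : M) : P.lineBundle.Fiber x →ₗ⋆[ℂ] P.lineBundle.Fiber x →ₗ[ℂ] ℂ :=
  lineMetric (P.coord x).toLinearMap 1

theorem metric_self (x : M) (a : P.lineBundle.Fiber x) :
    P.metric x a a = (starRingEnd ℂ) (P.coord x a) * P.coord x a := by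
  rw [metric, lineMetric_apply]; simp

theorem metric_unitVec (x : M) (p : P.bundle.Fiber x) : P.metric x (P.unitVec x p) (P.unitVec x p) = 1 := by
  rw [metric_self, coord_unitVec, Spin2.conj_mul_toComplex]

theorem exists_unitVec_eq (x : M) {a : P.lineBundle.Fiber x} (ha : P.metric x a a = 1) :
    ∃ p, P.unitVec x p = a := by
  rw [metric_self] at ha
  obtain ⟨g, hg⟩ := Spin2.exists_toComplex_eq ha
  refine ⟨P.basePoint x <• g, (P.coord x).injective ?_⟩
  rw [coord_unitVec, ← hg, P.bundle.diff_eq rfl]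

theorem unitVec_injective (x : M) : Function.Injective (P.unitVec x) := fun p q h => by
  have h1 := congrArg (P.coord x) h
  rw [coord_unitVec, coord_unitVec] at h1
  rw [← P.bundle.smul_diff (P.basePoint x) p, Spin2.toComplex_injective h1, P.bundle.smul_diff]

/-- The Hermitian line bundle associated with a spin structure. -/
def hermitianLineBundle : HermitianLineBundle.{w} E M where
  toSmoothLineBundle := P.lineBundle
  metric := P.metric
  conj_symm _ _ _ := lineMetric_conj_symm _ _ _ _
  pos x a ha := by
    rw [metric_self, ← Complex.normSq_eq_conj_mul_self, Complex.ofReal_re]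
    exact Complex.normSq_pos.2 (by simpa using ha)
  smooth_metric := by
    refine contMDiffOn_metric P.metric fun x => ?_
    obtain ⟨τ, hτ, hx⟩ := P.bundle.exists_mem_atlas x
    refine ⟨_, P.isSmooth_unitVec hτ x hx, ?_, ?_⟩
    · rw [(τ.map P.unitVec).extend_of_mem hx]
      exact P.unitVec_ne_zero x _
    · refine (contMDiffAt_const (c := (1 : ℂ))).congr_of_eventuallyEq ?_
      filter_upwards [τ.domain.isOpen.mem_nhds hx] with y hy
      rw [(τ.map P.unitVec).extend_of_mem hy]
      exact P.metric_unitVec y _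

/-- The quadratic map `[p, z] ↦ [f p, z²]`. -/
def quad (x : M) : QuadraticMap ℂ (P.lineBundle.Fiber x) (Q.associatedLineBundle.Fiber x) :=
  (LinearMap.toSpanSingleton ℂ _ (Q.associatedMk (P.toFun x (P.basePoint x)) 1)).compQuadraticMap
    ((QuadraticMap.sq (R := ℂ)).comp (P.coord x).toLinearMap)

theorem quad_apply (x : M) (a : P.lineBundle.Fiber x) : P.quad x a =
    (P.coord x a * P.coord x a) • Q.associatedMk (P.toFun x (P.basePoint x)) 1 := rfl

/-- Independence of the base point: if `p = p₀ · g`, equivariance of `P → Q` multiplies `[f p₀, 1]`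
by the rotation covered by `g`, which is the square of the coordinate of `[p, 1]`. -/
theorem quad_unitVec (x : M) (p : P.bundle.Fiber x) :
    P.quad x (P.unitVec x p) = Q.associatedMk (P.toFun x p) 1 := by
  conv_rhs => rw [← P.bundle.smul_diff (P.basePoint x) p, P.map_smul, Q.associatedMk_smul_one]
  rw [quad_apply, coord_unitVec, Spin2.toComplex_spinCover]

theorem metric_quad (x : M) (a : P.lineBundle.Fiber x) (ha : P.metric x a a = 1) :
    Q.associatedLineBundle.metric x (P.quad x a) (P.quad x a) = 1 := by
  obtain ⟨p, rfl⟩ := P.exists_unitVec_eq x ha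
  rw [quad_unitVec, Q.metric_associatedMk]

/-- The Hermitian square root associated with a spin structure. -/
def toHermitian : HermitianSqrt.{w} Q.associatedLineBundle where
  bundle := P.hermitianLineBundle
  quad := P.quad
  surjective x b := by
    obtain ⟨z, rfl⟩ := exists_smul_eq
      (Q.associatedMk_one_ne_zero (P.toFun x (P.basePoint x))) b
    -- Surjectivity is the existence of square roots in `ℂ`.
    obtain ⟨t, rfl⟩ := IsAlgClosed.exists_pow_nat_eq z two_pos
    refine ⟨(P.coord x).symm t, ?_⟩
    exact (P.quad_apply x _).trans (by rw [LinearEquiv.apply_symm_apply, sq])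
  smooth := by
    -- Tested on `[τ, 1]`, whose image is `[f τ, 1]`; this is smooth because `f` takes smooth
    -- sections of `P` to smooth sections of `Q`.
    refine contMDiff_of_homogeneous (fun x => P.quad x) 2 (fun x z a => quad_smul _ z a)
      fun x => ?_
    obtain ⟨τ, hτ, hx⟩ := P.bundle.exists_mem_atlas x
    have h1 := (Q.isSmooth_iff_associatedMk _).1
      (P.smooth τ ((P.isSmooth_iff_unitVec τ).2 (P.isSmooth_unitVec hτ)))
    refine ⟨_, P.isSmooth_unitVec hτ x hx, ?_, SectionAt.congr (h1 x hx) ?_⟩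
    · rw [(τ.map P.unitVec).extend_of_mem hx]
      exact P.unitVec_ne_zero x _
    · filter_upwards [τ.domain.isOpen.mem_nhds hx] with y hy
      rw [(τ.map P.unitVec).extend_of_mem hy]
      exact (P.quad_unitVec y _).trans
        (((τ.map P.toFun).map fun _ q => Q.associatedMk q 1).extend_of_mem hy).symm
  unit := P.metric_quad

/-- The points of a fibre of a spin structure are the unit vectors of the associated line. -/
def unitEquiv (x : M) : P.bundle.Fiber x ≃ P.hermitianLineBundle.UnitFiber x :=
  Equiv.ofBijective (fun p => ⟨P.unitVec x p, P.metric_unitVec x p⟩)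
    ⟨fun _ _ h => P.unitVec_injective x (congrArg HermitianLineBundle.UnitFiber.val h),
      fun a => (P.exists_unitVec_eq x a.metric_eq).imp fun _ h => HermitianLineBundle.UnitFiber.ext h⟩

theorem unitEquiv_val (x : M) (p : P.bundle.Fiber x) : (P.unitEquiv x p).val = P.unitVec x p := rfl

theorem unitVec_unitEquiv_symm (x : M) (a : P.hermitianLineBundle.UnitFiber x) :
    P.unitVec x ((P.unitEquiv x).symm a) = a.val := by
  rw [← unitEquiv_val, Equiv.apply_symm_apply]

/-- A spin structure is equivalent to that of the unit vectors of the associated Hermitian square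
root. -/
def homUnit : Hom P P.toHermitian.toSpin where
  toEquiv := P.unitEquiv
  map_smul x p g := HermitianLineBundle.UnitFiber.ext (P.unitVec_smul x p g)
  smooth σ hσ :=
    (HermitianLineBundle.unitBundle_isSmooth_iff _ _).2 ((P.isSmooth_iff_unitVec σ).1 hσ)
  smooth_symm σ hσ := by
    -- Pulling a unit section back to `P` and including it again in the line bundle returns the same
    -- section, so its smoothness is already known.
    have h1 : (LocalSection.map (fun x => (P.unitEquiv x).symm) σ).map P.unitVec =
        LocalSection.map (fun _ => HermitianLineBundle.UnitFiber.val) σ :=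
      congrArg (LocalSection.mk σ.domain) (funext fun x => funext fun hx =>
        P.unitVec_unitEquiv_symm x (σ.toFun x hx))
    refine (P.isSmooth_iff_unitVec _).2 ?_
    exact h1 ▸ (HermitianLineBundle.unitBundle_isSmooth_iff _ _).1 hσ
  comm x p := Q.associatedMk_one_injective <|
    (P.toHermitian.associatedMk_unitMap x (P.unitEquiv x p)).trans (P.quad_unitVec x p)

end SpinStructure

open HermitianSqrt in
theorem spinFunctor_isEquivalence {E : Type v} [NormedAddCommGroup E] [NormedSpace ℝ E]
    {M : Type u} [TopologicalSpace M] [ChartedSpace E M] (Q : PrincipalBundle.{w'} E M SO2) :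
    (spinFunctor.{w} Q).IsEquivalence where
  essSurj := ⟨fun P => ⟨P.toHermitian, ⟨P.homUnit.iso.symm⟩⟩⟩

/-! ## Holomorphic square roots -/

section HolomorphicSquareRoots

open Filter Topology

variable {E : Type v} [NormedAddCommGroup E] [NormedSpace ℂ E]
  {M : Type u} [TopologicalSpace M] [ChartedSpace E M]

theorem SmoothLineBundle.SmoothMap.smoothAt {E : Type v} [NormedAddCommGroup E] [NormedSpace ℝ E]
    {M : Type u} [TopologicalSpace M] [ChartedSpace E M] {N : SmoothLineBundle.{w} E M}
    {N' : SmoothLineBundle.{w'} E M} {f : ∀ x, N.Fiber x → N'.Fiber x} (hf : N.SmoothMap N' f)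
    {s : ∀ x, N.Fiber x} {x : M} (hs : N.SmoothAt s x) : N'.SmoothAt (fun y => f y (s y)) x :=
  SectionAt.map hf hs

theorem HolomorphicLineBundle.exists_localFrame (N : HolomorphicLineBundle.{w} E M) (x : M) :
    ∃ (U : TopologicalSpace.Opens M) (s : ∀ x, N.Fiber x), x ∈ U ∧
      ∀ y ∈ U, N.HolomorphicAt s y ∧ s y ≠ 0 := by
  let e := trivializationAt ℂ N.Fiber x
  exact ⟨⟨e.baseSet, e.open_baseSet⟩, fun x => e.symm x 1, mem_baseSet_trivializationAt ℂ N.Fiber x,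
    fun y hy => ⟨sectionAt_frame e hy 1, symm_one_ne_zero e hy⟩⟩

/-- Holomorphic sections are smooth. -/
theorem HolomorphicLineBundle.HolomorphicAt.smoothAt {N : HolomorphicLineBundle.{w} E M}
    {s : ∀ x, N.Fiber x} {x : M} (h : N.HolomorphicAt s x) : N.toSmooth.SmoothAt s x := by
  have h1 : ContMDiffAt 𝓘(ℂ, E) (𝓘(ℂ, E).prod 𝓘(ℂ, ℂ)) ω (fun x => TotalSpace.mk' ℂ x (s x)) x := h
  change ContMDiffAt 𝓘(ℝ, E) (𝓘(ℝ, E).prod 𝓘(ℝ, ℂ)) ∞ (fun x => TotalSpace.mk' ℂ x (s x)) x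
  rw [ContMDiffAt, contMDiffWithinAt_iff] at h1 ⊢
  exact ⟨h1.1, (h1.2.restrict_scalars ℝ).of_le le_top⟩

/-- A continuous function is holomorphic if its square is the ratio of holomorphic sections. -/
theorem contMDiffAt_of_sq_smul {L : HolomorphicLineBundle.{w} E M} {s t : ∀ x, L.Fiber x}
    {c : M → ℂ} {x : M} (hs : L.HolomorphicAt s x) (ht : L.HolomorphicAt t x) (hs0 : s x ≠ 0)
    (ht0 : t x ≠ 0) (hc : ContinuousAt c x) (h : ∀ᶠ y in 𝓝 x, s y = c y ^ 2 • t y) :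
    ContMDiffAt 𝓘(ℂ, E) 𝓘(ℂ, ℂ) ω c x := by
  refine contMDiffAt_of_sq ℂ ω hc (fun h0 => hs0 ?_) (SectionAt.coeff hs ht ht0 h)
  rw [h.self_of_nhds, h0, sq, zero_mul, zero_smul]

/-! ### Smooth isomorphisms of holomorphic square roots are holomorphic -/

namespace HolomorphicSqrt

theorem quad_ne_zero {L : HolomorphicLineBundle.{w'} E M} (N : HolomorphicSqrt.{w} L) {x : M}
    {a : N.bundle.Fiber x} (ha : a ≠ 0) : N.quad x a ≠ 0 := by
  have : Nontrivial (L.Fiber x) := inferInstanceAs (Nontrivial (L.toSmooth.Fiber x))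
  exact SquareRoot.quad_ne_zero (N.quad x) (N.surjective x) (fun _ h b => exists_smul_eq h b) ha

/-- A smooth linear map between holomorphic square roots that commutes with the quadratic maps is
holomorphic. -/
theorem holomorphicMap_of_smoothMap {L : HolomorphicLineBundle.{w'} E M}
    {N N' : HolomorphicSqrt.{w} L} (F : ∀ x, N.bundle.Fiber x →ₗ[ℂ] N'.bundle.Fiber x)
    (hF : N.bundle.toSmooth.SmoothMap N'.bundle.toSmooth fun x => F x)
    (hq : ∀ x a, N'.quad x (F x a) = N.quad x a) :
    N.bundle.HolomorphicMap N'.bundle fun x => F x := by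
  refine contMDiff_of_homogeneous (fun x => F x) 1 (fun x z a => by simp) fun x => ?_
  obtain ⟨U, s, hx, hs⟩ := N.bundle.exists_localFrame x
  obtain ⟨U', t, hx', ht⟩ := N'.bundle.exists_localFrame x
  have hs1 := (hs x hx).1.smoothAt
  have ht1 := (ht x hx').1.smoothAt
  have h1 : N'.bundle.toSmooth.SmoothAt (fun y => F y (s y)) x :=
    SmoothLineBundle.SmoothMap.smoothAt hF hs1
  obtain ⟨c, hc, hc'⟩ := SmoothLineBundle.exists_coeff h1 ht1 (ht x hx').2
  have hc2 : ∀ᶠ y in 𝓝 x, F y (s y) = (c y • t y : N'.bundle.Fiber y) := hc'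
  have hqs : L.HolomorphicAt (fun y => N.quad y (s y)) x :=
    SectionAt.map (f := fun y => N.quad y) N.holomorphic (hs x hx).1
  have hqt : L.HolomorphicAt (fun y => N'.quad y (t y)) x :=
    SectionAt.map (f := fun y => N'.quad y) N'.holomorphic (ht x hx').1
  -- So far `c` is only smooth. Applying the quadratic map to `F s = c t` gives `q(s) = c² q'(t)`
  -- with both sections holomorphic, which makes `c` holomorphic.
  have h2 := contMDiffAt_of_sq_smul hqs hqt (N.quad_ne_zero (hs x hx).2)
    (N'.quad_ne_zero (ht x hx').2) hc.continuousAt (hc2.mono fun y hy => by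
      rw [← hq, hy, quad_smul])
  exact ⟨s, (hs x hx).1, (hs x hx).2, SectionAt.congr (SectionAt.smul (ht x hx').1 h2) hc2⟩

variable {L : SmoothLineBundle.{w''} E M} (h : HolomorphicStructure.{w'', w'} L)

instance : (forget.{w} h).Faithful where
  map_injective hφ := Hom.ext
    (congrArg (fun f : SmoothSqrt.Hom _ _ => f.toEquiv) hφ :)

instance : (forget.{w} h).Full where
  map_surjective {N N'} φ := by
    have hq : ∀ x (a : N.bundle.Fiber x), N'.quad x (φ.toEquiv x a) = N.quad x a := fun x a =>
      (h.iso.toEquiv x).injective (φ.comm x a)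
    exact ⟨{ toEquiv := φ.toEquiv
             holomorphic := holomorphicMap_of_smoothMap (fun x => (φ.toEquiv x).toLinearMap)
               φ.smooth hq
             holomorphic_symm := holomorphicMap_of_smoothMap
               (fun x => (φ.toEquiv x).symm.toLinearMap) φ.smooth_symm fun x a =>
                 (hq x _).symm.trans (congrArg _ ((φ.toEquiv x).apply_symm_apply a))
             comm := hq }, rfl⟩

end HolomorphicSqrt

/-! ### The holomorphic structure of a smooth square root -/

namespace SmoothSqrt

variable {L : SmoothLineBundle.{w''} E M} (h : HolomorphicStructure.{w'', w'} L)
  (N : SmoothSqrt.{w} L)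

/-- The quadratic map to the holomorphic line bundle. -/
def holomorphicQuad (x : M) : QuadraticMap ℂ (N.bundle.Fiber x) (h.bundle.Fiber x) :=
  (h.iso.toEquiv x).symm.toLinearMap.compQuadraticMap (N.quad x)

theorem iso_holomorphicQuad (x : M) (a : N.bundle.Fiber x) :
    h.iso.toEquiv x (N.holomorphicQuad h x a) = N.quad x a :=
  (h.iso.toEquiv x).apply_symm_apply _

theorem holomorphicQuad_ne_zero {x : M} {a : N.bundle.Fiber x} (ha : a ≠ 0) :
    N.holomorphicQuad h x a ≠ 0 := fun h0 => N.quad_ne_zero ha <| by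
  rw [← N.iso_holomorphicQuad h, h0]; exact map_zero _

theorem smoothMap_holomorphicQuad :
    N.bundle.SmoothMap h.bundle.toSmooth fun x => N.holomorphicQuad h x :=
  ContMDiff.comp h.iso.smooth_symm N.smooth

/-- A local frame of a smooth square root is holomorphic if its image is. -/
structure IsHolomorphicFrame (σ : LocalSection N.bundle.Fiber) : Prop where
  ne_zero : ∀ x (hx : x ∈ σ.domain), σ.toFun x hx ≠ 0
  smooth : ∀ x ∈ σ.domain, N.bundle.SmoothAt σ.extend x
  holomorphic : ∀ x ∈ σ.domain, h.bundle.HolomorphicAt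
    (fun x => N.holomorphicQuad h x (σ.extend x)) x

/-- With smooth `s` and holomorphic `t`, write `q(s) = f t`. Near `x` there is a smooth `g` with `g²
= f`, and then `g⁻¹ s` is mapped to `t` itself. -/
theorem exists_isHolomorphicFrame (x : M) : ∃ σ, N.IsHolomorphicFrame h σ ∧ x ∈ σ.domain := by
  obtain ⟨U, s, hxU, hs⟩ := N.bundle.exists_localFrame x
  obtain ⟨U', t, hxU', ht⟩ := h.bundle.exists_localFrame x
  have hqs : ∀ y ∈ U, h.bundle.toSmooth.SmoothAt (fun y => N.holomorphicQuad h y (s y)) y :=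
    fun y hy => SmoothLineBundle.SmoothMap.smoothAt (N.smoothMap_holomorphicQuad h) (hs y hy).1
  have hf : ∀ y, ∃ z : ℂ, y ∈ U' → N.holomorphicQuad h y (s y) = z • t y := fun y => by
    by_cases hy : y ∈ U'
    · exact (exists_smul_eq (ht y hy).2 _).imp fun _ h _ => h
    · exact ⟨0, fun h => absurd h hy⟩
  choose f hf using hf
  have hfs : ∀ y ∈ U ⊓ U', ContMDiffAt 𝓘(ℝ, E) 𝓘(ℝ, ℂ) ∞ f y := fun y hy =>
    SectionAt.coeff (hqs y hy.1) (ht y hy.2).1.smoothAt (ht y hy.2).2 <| by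
      filter_upwards [U'.isOpen.mem_nhds hy.2] with z hz using hf z hz
  have hf0 : ∀ y ∈ U ⊓ U', f y ≠ 0 := fun y hy h0 =>
    N.holomorphicQuad_ne_zero h (hs y hy.1).2 (by rw [hf y hy.2, h0, zero_smul])
  obtain ⟨r, hr⟩ := IsAlgClosed.exists_pow_nat_eq (f x) two_pos
  have hr0 : r ≠ 0 := by
    rintro rfl
    exact hf0 x ⟨hxU, hxU'⟩ (by rw [← hr]; simp)
  -- The identity `g² = f` holds everywhere; smoothness of `g` needs `f / r²` in the slit plane,
  -- which defines the domain `W` below. It contains `x`, because `r² = f x` makes the quotient `1`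
  -- there.
  let g : M → ℂ := fun y => r * (f y / r ^ 2) ^ (2⁻¹ : ℂ)
  have hg2 : ∀ y, g y ^ 2 = f y := fun y => sqrt_sq (f y) hr0
  have hcont : ContinuousOn (fun y => f y / r ^ 2) (U ⊓ U' : TopologicalSpace.Opens M) :=
    fun y hy => ((hfs y hy).continuousAt.div_const _).continuousWithinAt
  let W : TopologicalSpace.Opens M :=
    ⟨_, hcont.isOpen_inter_preimage (U ⊓ U').isOpen Complex.isOpen_slitPlane⟩
  have hW : ∀ y ∈ W, y ∈ U ∧ y ∈ U' ∧ f y / r ^ 2 ∈ Complex.slitPlane := fun y hy =>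
    ⟨hy.1.1, hy.1.2, hy.2⟩
  have hg0 : ∀ y ∈ W, g y ≠ 0 := fun y hy h0 => hf0 y hy.1 (by rw [← hg2, h0]; simp)
  let σ : LocalSection N.bundle.Fiber := ⟨W, fun y _ => (g y)⁻¹ • s y⟩
  have hσ : ∀ y ∈ W, σ.extend y = (g y)⁻¹ • s y := fun y hy => σ.extend_of_mem hy
  refine ⟨σ, ⟨fun y hy => ?_, fun y hy => ?_, fun y hy => ?_⟩, ?_⟩
  · exact smul_ne_zero (inv_ne_zero (hg0 y hy)) (hs y hy.1.1).2
  · have h1 := contMDiffAt_sqrt ℝ ∞ r (hfs y hy.1) hy.2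
    have h2 := contMDiffAt_div (contMDiffAt_const (c := (1 : ℂ))) h1 (hg0 y hy)
    refine SectionAt.congr (SectionAt.smul (hs y hy.1.1).1 h2) ?_
    filter_upwards [W.isOpen.mem_nhds hy] with z hz
    rw [hσ z hz, one_div]
  · refine SectionAt.congr (ht y hy.1.2).1 ?_
    filter_upwards [W.isOpen.mem_nhds hy] with z hz
    rw [hσ z hz, quad_smul, hf z hz.1.2, smul_smul, inv_pow, hg2,
      inv_mul_cancel₀ (hf0 z hz.1), one_smul]
  · refine ⟨⟨hxU, hxU'⟩, ?_⟩
    change f x / r ^ 2 ∈ Complex.slitPlane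
    rw [hr, div_self (hf0 x ⟨hxU, hxU'⟩)]
    simp

/-- The holomorphic frames of a smooth square root. -/
def holomorphicFrameAtlas : FrameAtlas ℂ ω E N.bundle.Fiber where
  frames := {σ | N.IsHolomorphicFrame h σ}
  existsUnique_smul σ hσ x hx a := by
    obtain ⟨z, rfl⟩ := exists_smul_eq (hσ.ne_zero x hx) a
    exact ⟨z, rfl, fun z' hz' => smul_left_injective ℂ (hσ.ne_zero x hx) hz'⟩
  exists_mem := N.exists_isHolomorphicFrame h
  contMDiffOn σ hσ τ hτ := by
    have hc : ∀ x, ∃ c : ℂ, ∀ (h1 : x ∈ σ.domain) (h2 : x ∈ τ.domain),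
        σ.toFun x h1 = c • τ.toFun x h2 := fun x => by
      by_cases hx : x ∈ σ.domain ∧ x ∈ τ.domain
      · exact (exists_smul_eq (hτ.ne_zero x hx.2) (σ.toFun x hx.1)).imp fun _ h _ _ => h
      · exact ⟨0, fun h1 h2 => absurd ⟨h1, h2⟩ hx⟩
    choose c hc using hc
    refine ⟨c, fun x hx => ContMDiffAt.contMDiffWithinAt ?_, hc⟩
    have hev : ∀ᶠ y in 𝓝 x, σ.extend y = c y • τ.extend y := by
      filter_upwards [σ.domain.isOpen.mem_nhds hx.1, τ.domain.isOpen.mem_nhds hx.2] with y h1 h2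
      rw [σ.extend_of_mem h1, τ.extend_of_mem h2, hc y h1 h2]
    have hσ0 : σ.extend x ≠ 0 := by rw [σ.extend_of_mem hx.1]; exact hσ.ne_zero x hx.1
    have hτ0 : τ.extend x ≠ 0 := by rw [τ.extend_of_mem hx.2]; exact hτ.ne_zero x hx.2
    -- Smoothness of the frames yields continuity of `c`, without which a holomorphic `c²` would not
    -- fix the branch.
    have h1 := SectionAt.coeff (hσ.smooth x hx.1) (hτ.smooth x hx.2) hτ0 hev
    refine contMDiffAt_of_sq_smul (hσ.holomorphic x hx.1) (hτ.holomorphic x hx.2)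
      (N.holomorphicQuad_ne_zero h hσ0) (N.holomorphicQuad_ne_zero h hτ0) h1.continuousAt ?_
    filter_upwards [hev] with y hy
    rw [hy, quad_smul]

/-- The holomorphic line bundle underlying a smooth square root of a holomorphic line bundle. -/
def holomorphicBundle : HolomorphicLineBundle.{w} E M := (N.holomorphicFrameAtlas h).toHolomorphic

/-- The identity map to the underlying smooth line bundle. -/
def holomorphicEquiv (x : M) : (N.holomorphicBundle h).Fiber x ≃ₗ[ℂ] N.bundle.Fiber x :=
  LinearEquiv.refl ℂ (N.bundle.Fiber x)

/-- One section that is at once holomorphic for the new structure and smooth for the original one.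
Testing on it shows that the identity is smooth in both directions and that the quadratic map is
holomorphic. -/
theorem exists_holomorphicFrame (x : M) : ∃ s : ∀ x, (N.holomorphicBundle h).Fiber x,
    (N.holomorphicBundle h).HolomorphicAt s x ∧ s x ≠ 0 ∧
      N.bundle.SmoothAt (fun y => N.holomorphicEquiv h y (s y)) x ∧
      h.bundle.HolomorphicAt
        (fun y => N.holomorphicQuad h y (N.holomorphicEquiv h y (s y))) x := by
  obtain ⟨σ, hσ, hx⟩ := N.exists_isHolomorphicFrame h x
  refine ⟨_, (N.holomorphicFrameAtlas h).holomorphicAt_extend hσ hx, ?_, hσ.smooth x hx,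
    hσ.holomorphic x hx⟩
  have : σ.extend x ≠ 0 := by rw [σ.extend_of_mem hx]; exact hσ.ne_zero x hx
  exact this

/-- The smooth line bundle underlying the holomorphic line bundle is the given one. -/
def holomorphicIso : SmoothLineBundle.Iso (N.holomorphicBundle h).toSmooth N.bundle where
  toEquiv := N.holomorphicEquiv h
  smooth := by
    refine contMDiff_of_homogeneous (V := (N.holomorphicBundle h).toSmooth.Fiber)
      (fun x => N.holomorphicEquiv h x) 1 (fun x z a => ?_) fun x => ?_
    · rw [pow_one]; exact map_smul (N.holomorphicEquiv h x) z a
    · obtain ⟨s, h1, h2, h3, -⟩ := N.exists_holomorphicFrame h x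
      exact ⟨s, h1.smoothAt, h2, h3⟩
  smooth_symm := by
    refine contMDiff_of_homogeneous (V' := (N.holomorphicBundle h).toSmooth.Fiber)
      (fun x => (N.holomorphicEquiv h x).symm) 1 (fun x z a => ?_) fun x => ?_
    · rw [pow_one]; exact map_smul (N.holomorphicEquiv h x).symm z a
    · obtain ⟨s, h1, h2, h3, -⟩ := N.exists_holomorphicFrame h x
      exact ⟨_, h3, h2, h1.smoothAt⟩

/-- The holomorphic square root underlying a smooth square root. -/
def toHolomorphic : HolomorphicSqrt.{w} h.bundle where
  bundle := N.holomorphicBundle h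
  quad x := (N.holomorphicQuad h x).comp (N.holomorphicEquiv h x).toLinearMap
  surjective x := ((h.iso.toEquiv x).symm.surjective.comp (N.surjective x)).comp
    (N.holomorphicEquiv h x).surjective
  holomorphic := by
    refine contMDiff_of_homogeneous
      (fun x => (N.holomorphicQuad h x).comp (N.holomorphicEquiv h x).toLinearMap) 2
      (fun x z a => quad_smul _ z a) fun x => ?_
    obtain ⟨s, h1, h2, -, h3⟩ := N.exists_holomorphicFrame h x
    exact ⟨s, h1, h2, h3⟩

/-- The inverse of an equivalence of smooth square roots. -/
def Hom.symm {L : SmoothLineBundle.{w'} E M} {N N' : SmoothSqrt.{w} L} (φ : Hom N N') :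
    Hom N' N where
  toEquiv x := (φ.toEquiv x).symm
  smooth := φ.smooth_symm
  smooth_symm := φ.smooth
  comm x a := by rw [← φ.comm, LinearEquiv.apply_symm_apply]

/-- An equivalence of smooth square roots as an isomorphism in the category. -/
def Hom.iso {L : SmoothLineBundle.{w'} E M} {N N' : SmoothSqrt.{w} L} (φ : Hom N N') :
    N ≅ N' where
  hom := φ
  inv := φ.symm
  hom_inv_id := Hom.ext (funext fun x => LinearEquiv.self_trans_symm (φ.toEquiv x))
  inv_hom_id := Hom.ext (funext fun x => LinearEquiv.symm_trans_self (φ.toEquiv x))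

/-- The smooth square root underlying the holomorphic one is the given one. -/
def forgetHom : Hom ((HolomorphicSqrt.forget.{w} h).obj (N.toHolomorphic h)) N where
  toIso := N.holomorphicIso h
  comm x _ := (N.iso_holomorphicQuad h x _).symm

end SmoothSqrt

theorem HolomorphicSqrt.forget_isEquivalence {L : SmoothLineBundle.{w''} E M}
    (h : HolomorphicStructure.{w'', w'} L) : (HolomorphicSqrt.forget.{w} h).IsEquivalence where
  essSurj := ⟨fun N => ⟨N.toHolomorphic h, ⟨(N.forgetHom h).iso⟩⟩⟩

end HolomorphicSquareRoots

end SquareRoot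

end

theorem mainTheorem10 :
    -- smooth manifolds
    (∀ {E : Type v} [NormedAddCommGroup E] [NormedSpace ℝ E] [FiniteDimensional ℝ E]
      {M : Type u} [TopologicalSpace M] [ChartedSpace E M] [IsManifold 𝓘(ℝ, E) ∞ M]
      (Q : SquareRoot.PrincipalBundle.{w'} E M SquareRoot.SO2),
      Nonempty (SquareRoot.SpinStructure.{w} Q ≌
        SquareRoot.HermitianSqrt.{w} Q.associatedLineBundle) ∧
      (SquareRoot.HermitianSqrt.forget.{w} Q.associatedLineBundle).IsEquivalence) ∧
    -- complex manifolds
    (∀ {E : Type v} [NormedAddCommGroup E] [NormedSpace ℂ E] [FiniteDimensional ℂ E]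
      {M : Type u} [TopologicalSpace M] [ChartedSpace E M] [IsManifold 𝓘(ℂ, E) ω M]
      (Q : SquareRoot.PrincipalBundle.{w'} E M SquareRoot.SO2)
      (h : SquareRoot.HolomorphicStructure.{0, w''} Q.associatedLineBundle.toSmoothLineBundle),
      Nonempty (SquareRoot.SpinStructure.{w} Q ≌
        SquareRoot.HermitianSqrt.{w} Q.associatedLineBundle) ∧
      (SquareRoot.HermitianSqrt.forget.{w} Q.associatedLineBundle).IsEquivalence ∧
      (SquareRoot.HolomorphicSqrt.forget.{w} h).IsEquivalence) := by
  refine ⟨fun Q => ⟨?_, ?_⟩, fun Q h => ⟨?_, ?_, ?_⟩⟩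
  · have := SquareRoot.spinFunctor_isEquivalence.{w} Q
    -- The functor of unit vectors goes from Hermitian square roots to spin structures, so its
    -- equivalence is reversed.
    exact ⟨(SquareRoot.HermitianSqrt.spinFunctor Q).asEquivalence.symm⟩
  · exact SquareRoot.HermitianSqrt.forget_isEquivalence _
  · have := SquareRoot.spinFunctor_isEquivalence.{w} Q
    exact ⟨(SquareRoot.HermitianSqrt.spinFunctor Q).asEquivalence.symm⟩
  · exact SquareRoot.HermitianSqrt.forget_isEquivalence _
  · exact SquareRoot.HolomorphicSqrt.forget_isEquivalence h
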